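/- Let $n,N,M,K$ be natural numbers, let $\hat D_1,\dots,\hat D_n\in\mathcal L(\mathbb C^N,\mathbb C^M)$, and consider the first-order constant-coefficient operator $D=-i\sum_{j=1}^n\hat D_j\partial_j$ with symbol $\hat D(\xi)=\sum_{j=1}^n\xi_j\hat D_j$, $\xi\in\mathbb R^n$. Suppose that $\dim\operatorname{range}(\hat D(\xi))$ is the same for all $\xi\in\mathbb R^n\setminus\{0\}$, and that $A\in\mathcal L(\mathbb C^M,\mathbb C^K)$ is a constant matrix for which there is $c>0$ with $$|A\hat D(\xi)v|\ge c\,|\hat D(\xi)v|\qquad\text{for all }\xi\in\mathbb R^n,\ v\in\mathbb C^N.$$ Then for every $p\in(1,\infty)$ there is a constant $C>0$ such that $$\|ADu\|_{L^p(\mathbb R^n;\mathbb C^K)}\ge C\,\|Du\|_{L^p(\mathbb R^n;\mathbb C^M)}\qquad\text{for all }u\in C_c^\infty(\mathbb R^n;\mathbb C^N).$$ -/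

import Mathlib

open MeasureTheory
open scoped ENNReal ContDiff

namespace ConstCoeff

/-- The symbol `D̂(ξ) = ∑ⱼ ξⱼ D̂ⱼ : ℂ^N → ℂ^M` of the operator with coefficients `D̂₁, …, D̂ₙ`. -/
noncomputable def symbol {n N M : ℕ}
    (Dhat : Fin n → EuclideanSpace ℂ (Fin N) →L[ℂ] EuclideanSpace ℂ (Fin M))
    (ξ : EuclideanSpace ℝ (Fin n)) :
    EuclideanSpace ℂ (Fin N) →L[ℂ] EuclideanSpace ℂ (Fin M) :=
  ∑ j, ((ξ j : ℝ) : ℂ) • Dhat j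

/-- The differential operator `D = -i ∑ⱼ D̂ⱼ ∂ⱼ` acting on (differentiable) functions
`u : ℝⁿ → ℂ^N`; here `∂ⱼ u (x)` is the derivative of `u` at `x` in the direction of the
`j`-th standard basis vector. -/
noncomputable def diffOp {n N M : ℕ}
    (Dhat : Fin n → EuclideanSpace ℂ (Fin N) →L[ℂ] EuclideanSpace ℂ (Fin M))
    (u : EuclideanSpace ℝ (Fin n) → EuclideanSpace ℂ (Fin N))
    (x : EuclideanSpace ℝ (Fin n)) : EuclideanSpace ℂ (Fin M) :=
  (-Complex.I) • ∑ j, Dhat j (fderiv ℝ u x (EuclideanSpace.single j (1 : ℝ)))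

end ConstCoeff

/-! At each frequency the Fourier transform of `Du` lies in the range of the symbol `D̂(ξ)`, and `A`
is injective on that range. Hence `Du` is recovered from `ADu` by the multiplier `m(ξ) = D̂(ξ) (A
D̂(ξ))⁺`, with `⁺` the Moore–Penrose inverse. Constant rank makes `m` smooth away from the origin;
uniqueness of the reconstruction makes it homogeneous of degree zero (`exists_multiplier`). What
remains is the `L^p` boundedness of such a multiplier, proved here by Calderón–Zygmund theory.

The multiplier is cut into dyadic frequency annuli. By homogeneity every piece has as kernel a
dilate of one Schwartz function, and the finite sums of these dilates are Schwartz kernels whose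
Fourier transforms and Hörmander constants are bounded independently of the number of pieces
(`exists_kernels`). For such kernels `L²` boundedness is Plancherel, the Calderón–Zygmund
decomposition gives weak type (1,1) (`IsCZ.weak_type_one`), truncation interpolates to `1 < p < 2`,
and duality gives `p > 2` (`IsCZ.eLpNorm_le`). The constants do not see the truncation, so Fatou's
lemma passes to the limit (`exists_eLpNorm_le_of_multiplier`). No singular integral has to be
defined: all convolutions are with Schwartz kernels. -/

namespace ConstCoeff

open Set Filter Topology FourierTransform SchwartzMap
open scoped NNReal

set_option linter.unusedSectionVars false

/-! ### Convolution with Schwartz kernels and the `L²` bound. -/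

section Convolution

variable {E : Type*} [NormedAddCommGroup E] [InnerProductSpace ℝ E] [FiniteDimensional ℝ E]
  [MeasurableSpace E] [BorelSpace E]

/-- The convolution of two scalar functions. -/
noncomputable def cconv (K f : E → ℂ) (x : E) : ℂ := ∫ y, K (x - y) * f y

lemma exists_norm_le (K : 𝓢(E, ℂ)) : ∃ C : ℝ, ∀ x, ‖K x‖ ≤ C :=
  ⟨_, fun x => SchwartzMap.norm_le_seminorm ℝ K x⟩

lemma integrable_cconv_integrand (K : 𝓢(E, ℂ)) {f : E → ℂ} (hf : Integrable f) (x : E) :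
    Integrable fun y => K (x - y) * f y := by
  obtain ⟨C, hC⟩ := exists_norm_le K
  refine hf.bdd_mul (c := C) ?_ (ae_of_all _ fun y => hC _)
  exact (K.continuous.comp (by fun_prop)).aestronglyMeasurable

lemma continuous_cconv (K : 𝓢(E, ℂ)) {f : E → ℂ} (hf : Integrable f) :
    Continuous (cconv K f) := by
  obtain ⟨C, hC⟩ := exists_norm_le K
  refine continuous_of_dominated (bound := fun y => C * ‖f y‖)
    (fun x => (integrable_cconv_integrand K hf x).aestronglyMeasurable) (fun x => ae_of_all _ fun y => ?_)
    (hf.norm.const_mul _) (ae_of_all _ fun y => ?_)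
  · rw [norm_mul]; gcongr; exact hC _
  · exact (K.continuous.comp (by fun_prop)).mul continuous_const

lemma cconv_add (K : 𝓢(E, ℂ)) {f g : E → ℂ} (hf : Integrable f) (hg : Integrable g) (x : E) :
    cconv K (fun y => f y + g y) x = cconv K f x + cconv K g x := by
  unfold cconv
  rw [← integral_add (integrable_cconv_integrand K hf x) (integrable_cconv_integrand K hg x)]
  simp only [mul_add]

lemma norm_cconv_le (K : 𝓢(E, ℂ)) {f : E → ℂ} {C : ℝ} (hf : Integrable f) (hC : ∀ x, ‖K x‖ ≤ C)
    (x : E) : ‖cconv K f x‖ ≤ C * ∫ y, ‖f y‖ := by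
  rw [← integral_const_mul]
  refine norm_integral_le_of_norm_le (hf.norm.const_mul _) (ae_of_all _ fun y => ?_)
  rw [norm_mul]; gcongr; exact hC _

lemma cconv_eq_convolution (K f : 𝓢(E, ℂ)) (x : E) :
    cconv K f x = SchwartzMap.convolution (ContinuousLinearMap.mul ℂ ℂ) K f x := by
  rw [SchwartzMap.convolution_apply]
  rw [convolution_mul_swap, cconv]

lemma integrable_cconv (K : 𝓢(E, ℂ)) {f : E → ℂ} (hf : Integrable f) :
    Integrable (cconv K f) := by
  have := K.integrable (μ := volume) |>.integrable_convolution (ContinuousLinearMap.mul ℂ ℂ) hf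
  exact this.congr (ae_of_all _ fun x => by rw [convolution_mul_swap, cconv])

/-- A Schwartz kernel whose Fourier transform is bounded by `B` and which satisfies Hörmander's
regularity condition with constant `B`. -/
structure IsCZ (K : 𝓢(E, ℂ)) (B : ℝ≥0) : Prop where
  norm_fourier_le : ∀ ξ, ‖(𝓕 K : 𝓢(E, ℂ)) ξ‖ ≤ B
  lintegral_sub_le : ∀ y : E, ∫⁻ x in {x | 2 * ‖y‖ ≤ ‖x‖}, ‖K (x - y) - K x‖ₑ ≤ B

lemma eLpNorm_two_fourier (f : 𝓢(E, ℂ)) : 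
    eLpNorm (⇑(𝓕 f : 𝓢(E, ℂ))) 2 volume = eLpNorm (⇑f) 2 volume := by
  have h := SchwartzMap.norm_fourier_toL2_eq f
  rw [SchwartzMap.norm_toLp, SchwartzMap.norm_toLp] at h
  have h1 : eLpNorm (⇑(𝓕 f : 𝓢(E, ℂ))) 2 volume ≠ ⊤ :=
    ((𝓕 f : 𝓢(E, ℂ)).memLp 2 volume).eLpNorm_ne_top
  have h2 : eLpNorm (⇑f) 2 volume ≠ ⊤ := (f.memLp 2 volume).eLpNorm_ne_top
  exact (ENNReal.toReal_eq_toReal_iff' h1 h2).1 h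

/-- Plancherel on both sides: the transform of the convolution is a product, and one factor is
bounded by `B`. -/
lemma IsCZ.eLpNorm_two_schwartz {K : 𝓢(E, ℂ)} {B : ℝ≥0} (hK : IsCZ K B) (f : 𝓢(E, ℂ)) :
    eLpNorm (cconv K f) 2 volume ≤ B * eLpNorm f 2 volume := by
  have h : cconv K f = SchwartzMap.convolution (ContinuousLinearMap.mul ℂ ℂ) K f :=
    funext fun x => cconv_eq_convolution K f x
  rw [h, ← eLpNorm_two_fourier, SchwartzMap.fourier_convolution, ← eLpNorm_two_fourier f]
  refine eLpNorm_le_nnreal_smul_eLpNorm_of_ae_le_mul (ae_of_all _ fun ξ => ?_) 2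
  simp only [pairing_apply_apply, ContinuousLinearMap.mul_apply', nnnorm_mul]
  gcongr
  exact hK.norm_fourier_le ξ

/-- The `L²` bound for convolution with a Schwartz kernel. -/
lemma IsCZ.eLpNorm_two_le {K : 𝓢(E, ℂ)} {B : ℝ≥0} (hK : IsCZ K B) {f : E → ℂ}
    (hf : Integrable f) (hf2 : MemLp f 2) :
    eLpNorm (cconv K f) 2 volume ≤ B * eLpNorm f 2 volume := by
  -- Extension by density. As `K (x - ·)` is in `L²`, Cauchy–Schwarz turns `L²` convergence of the
  -- approximants into pointwise convergence of their convolutions, and Fatou preserves the bound.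
  have key : ∀ k : ℕ, ∃ g : 𝓢(E, ℂ), eLpNorm (f - ⇑g) 2 volume ≤ ENNReal.ofReal (1 / (k + 1)) := by
    intro k
    obtain ⟨g, hg1, hg2, hg3⟩ := hf2.exist_eLpNorm_sub_le (by simp) (by norm_num)
      (ε := 1 / ((k : ℝ) + 1)) (by positivity)
    exact ⟨hg1.toSchwartzMap hg2, hg3⟩
  choose g hg using key
  have hlim : Tendsto (fun k => eLpNorm (f - ⇑(g k)) 2 volume) atTop (𝓝 0) := by
    refine tendsto_of_tendsto_of_tendsto_of_le_of_le tendsto_const_nhds ?_ (fun _ => zero_le) hg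
    rw [← ENNReal.ofReal_zero]
    exact ENNReal.tendsto_ofReal tendsto_one_div_add_atTop_nhds_zero_nat
  have hpt : ∀ x, Tendsto (fun k => cconv K (g k) x) atTop (𝓝 (cconv K f x)) := by
    intro x
    rw [tendsto_iff_edist_tendsto_0]
    have hKx : MemLp (fun y => K (x - y)) 2 := (K.memLp 2).comp_measurePreserving
      (Measure.measurePreserving_sub_left volume x)
    refine tendsto_of_tendsto_of_tendsto_of_le_of_le tendsto_const_nhds
      (h := fun k => eLpNorm (fun y => K (x - y)) 2 volume * eLpNorm (f - ⇑(g k)) 2 volume) ?_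
      (fun _ => zero_le) fun k => ?_
    · simpa using ENNReal.Tendsto.const_mul hlim (Or.inr hKx.eLpNorm_ne_top)
    · have h1 : cconv K f x - cconv K (g k) x = ∫ y, K (x - y) * (f - ⇑(g k)) y := by
        unfold cconv
        rw [← integral_sub (integrable_cconv_integrand K hf x)
          (integrable_cconv_integrand K (g k).integrable x)]
        simp [mul_sub]
      rw [edist_comm, edist_eq_enorm_sub, h1]
      refine (enorm_integral_le_lintegral_enorm _).trans ?_
      have h2 := eLpNorm_smul_le_mul_eLpNorm (p := 2) (q := 2) (r := 1) (μ := volume)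
        (f := (f - ⇑(g k) : E → ℂ)) (φ := fun y => K (x - y))
        (hf.aestronglyMeasurable.sub (g k).continuous.aestronglyMeasurable) hKx.1
      rwa [eLpNorm_one_eq_lintegral_enorm] at h2
  refine (Lp.eLpNorm_lim_le_liminf_eLpNorm (f := fun k => cconv K (g k))
    (fun k => (continuous_cconv K (g k).integrable).aestronglyMeasurable) _
    (ae_of_all _ hpt)).trans ?_
  have h3 : ∀ k, eLpNorm (cconv K (g k)) 2 volume ≤
      B * (eLpNorm f 2 volume + eLpNorm (f - ⇑(g k)) 2 volume) := fun k => by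
    refine (hK.eLpNorm_two_schwartz (g k)).trans ?_
    gcongr
    have : (g k : E → ℂ) = f - (f - ⇑(g k)) := by simp
    conv_lhs => rw [this]
    exact eLpNorm_sub_le hf.aestronglyMeasurable
      (hf.aestronglyMeasurable.sub (g k).continuous.aestronglyMeasurable) (by norm_num)
  refine (liminf_le_liminf (Eventually.of_forall h3)).trans ?_
  refine (Tendsto.liminf_eq ?_).le
  have := ENNReal.Tendsto.const_mul (a := (B : ℝ≥0∞)) (tendsto_const_nhds.add hlim) (b := eLpNorm f 2 volume + 0) (Or.inr (by simp))
  simpa using this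

end Convolution

/-! ### Dyadic cubes and the stopping-time selection. -/

section Dyadic

variable {n : ℕ}

/-- The index of the dyadic cube of side `2 ^ (-k)` containing `x`. -/
noncomputable def cubeIndex (k : ℤ) (x : EuclideanSpace ℝ (Fin n)) : Fin n → ℤ :=
  fun i => ⌊(2 : ℝ) ^ k * x i⌋

/-- The dyadic cube of generation `s.1` with index `s.2`. -/
def cube (s : ℤ × (Fin n → ℤ)) : Set (EuclideanSpace ℝ (Fin n)) := {x | cubeIndex s.1 x = s.2}

lemma mem_cube_cubeIndex (k : ℤ) (x : EuclideanSpace ℝ (Fin n)) : x ∈ cube (k, cubeIndex k x) := rfl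

lemma cube_eq_preimage (s : ℤ × (Fin n → ℤ)) :
    cube s = (@WithLp.ofLp 2 (Fin n → ℝ)) ⁻¹' (Set.univ.pi fun i =>
      Ico ((2 : ℝ) ^ (-s.1) * s.2 i) ((2 : ℝ) ^ (-s.1) * (s.2 i + 1))) := by
  ext x
  have h2 : (0 : ℝ) < 2 ^ s.1 := by positivity
  simp only [cube, cubeIndex, mem_ofPred_eq, funext_iff, Int.floor_eq_iff, mem_preimage, Set.mem_pi,
    mem_univ, true_imp_iff, mem_Ico, zpow_neg,
    inv_mul_le_iff₀ h2, lt_inv_mul_iff₀ h2]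

lemma measurableSet_cube (s : ℤ × (Fin n → ℤ)) : MeasurableSet (cube s) := by
  rw [cube_eq_preimage]
  exact (PiLp.volume_preserving_ofLp (Fin n)).measurable
    (MeasurableSet.univ_pi fun i => measurableSet_Ico)

lemma volume_cube (s : ℤ × (Fin n → ℤ)) :
    volume (cube s) = ENNReal.ofReal ((2 : ℝ) ^ (-s.1)) ^ n := by
  rw [cube_eq_preimage, (PiLp.volume_preserving_ofLp (Fin n)).measure_preimage
    (MeasurableSet.univ_pi fun i => measurableSet_Ico).nullMeasurableSet, Real.volume_pi_Ico]
  simp [mul_add]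

lemma volume_cube_ne_zero (s : ℤ × (Fin n → ℤ)) : volume (cube s) ≠ 0 := by
  rw [volume_cube]
  have : (0 : ℝ) < 2 ^ (-s.1) := by positivity
  exact pow_ne_zero _ (by simpa using this)

lemma volume_cube_ne_top (s : ℤ × (Fin n → ℤ)) : volume (cube s) ≠ ⊤ := by
  rw [volume_cube]
  exact ENNReal.pow_ne_top ENNReal.ofReal_ne_top

lemma volume_cube_pred (k : ℤ) (z w : Fin n → ℤ) :
    volume (cube (k - 1, z)) = 2 ^ n * volume (cube (k, w)) := by
  rw [volume_cube, volume_cube, ← mul_pow]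
  congr 1
  rw [← ENNReal.ofReal_ofNat, ← ENNReal.ofReal_mul (by norm_num)]
  congr 1
  simp only [neg_sub]
  rw [sub_eq_add_neg, zpow_add₀ (by norm_num)]
  simp

lemma cube_nonempty (s : ℤ × (Fin n → ℤ)) : (cube s).Nonempty :=
  nonempty_of_measure_ne_zero (volume_cube_ne_zero s)

lemma cubeIndex_pred (k : ℤ) (x : EuclideanSpace ℝ (Fin n)) :
    cubeIndex (k - 1) x = fun i => cubeIndex k x i / 2 := by
  funext i
  simp only [cubeIndex]
  have h := Int.floor_div_natCast ((2 : ℝ) ^ k * x i) 2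
  rw [← Nat.cast_ofNat (n := 2) (R := ℤ), ← h]
  congr 1
  rw [zpow_sub₀ (by norm_num)]
  simp; ring

/-- Dyadic nesting: passing to the parent halves the index with rounding down, so a fine index
determines all coarser ones. Larger generations are smaller cubes. -/
lemma cubeIndex_eq_of_le {k l : ℤ} (hkl : k ≤ l) {x y : EuclideanSpace ℝ (Fin n)}
    (h : cubeIndex l x = cubeIndex l y) : cubeIndex k x = cubeIndex k y := by
  induction l, hkl using Int.leInduction with
  | base => exact h
  | succ l _ ih =>
    apply ih
    have := cubeIndex_pred (l + 1) x
    have h2 := cubeIndex_pred (l + 1) y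
    simp only [add_sub_cancel_right] at this h2
    rw [this, h2, h]

lemma cube_subset_of_le {k l : ℤ} (hkl : k ≤ l) (x : EuclideanSpace ℝ (Fin n)) :
    cube (l, cubeIndex l x) ⊆ cube (k, cubeIndex k x) :=
  fun _ hy => cubeIndex_eq_of_le hkl hy

lemma norm_sub_le_of_mem_cube {s : ℤ × (Fin n → ℤ)} {x y : EuclideanSpace ℝ (Fin n)}
    (hx : x ∈ cube s) (hy : y ∈ cube s) : ‖x - y‖ ≤ √n * 2 ^ (-s.1) := by
  have h2 : (0 : ℝ) < 2 ^ s.1 := by positivity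
  rw [EuclideanSpace.norm_eq]
  have : (√n * 2 ^ (-s.1) : ℝ) = √(∑ _i : Fin n, ((2 : ℝ) ^ (-s.1)) ^ 2) := by
    simp [Real.sqrt_sq h2.le]
  rw [this]
  refine Real.sqrt_le_sqrt (Finset.sum_le_sum fun i _ => ?_)
  gcongr
  have hi : ⌊(2 : ℝ) ^ s.1 * x i⌋ = ⌊(2 : ℝ) ^ s.1 * y i⌋ := (congrFun hx i).trans (congrFun hy i).symm
  have := (Int.abs_sub_lt_one_of_floor_eq_floor hi).le
  rw [← mul_sub, abs_mul, abs_of_pos h2] at this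
  rw [zpow_neg, PiLp.sub_apply, Real.norm_eq_abs, ← one_div, le_div_iff₀ h2]
  linarith

/-- Two cubes through a common point differ only in generation, and the coarser one would violate
the maximality of the finer one. -/
lemma pairwise_disjoint_cube_of_minimal (P : ℤ × (Fin n → ℤ) → Prop)
    {s t : ℤ × (Fin n → ℤ)} (hs : P s) (ht : P t)
    (hs' : ∀ x ∈ cube s, ∀ k < s.1, ¬ P (k, cubeIndex k x))
    (ht' : ∀ x ∈ cube t, ∀ k < t.1, ¬ P (k, cubeIndex k x)) (hst : s ≠ t) :
    Disjoint (cube s) (cube t) := by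
  rw [Set.disjoint_left]
  intro x hxs hxt
  have h1 : s = (s.1, cubeIndex s.1 x) := Prod.ext rfl (Eq.symm hxs)
  have h2 : t = (t.1, cubeIndex t.1 x) := Prod.ext rfl (Eq.symm hxt)
  rcases lt_trichotomy s.1 t.1 with h | h | h
  · exact ht' x hxt _ h (h1 ▸ hs)
  · apply hst; rw [h1, h2, h]
  · exact hs' x hxs _ h (h2 ▸ ht)

/-- The maximal dyadic cubes on which the average of `F` exceeds `L`. -/
theorem exists_stopping_cubes (hn : 0 < n) (F : EuclideanSpace ℝ (Fin n) → ℝ≥0∞)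
    (hF : ∫⁻ x, F x ≠ ⊤) {L : ℝ≥0∞} (hL0 : L ≠ 0) (hL : L ≠ ⊤) :
    ∃ S : Set (ℤ × (Fin n → ℤ)), S.PairwiseDisjoint cube ∧
      (∀ s ∈ S, L * volume (cube s) ≤ ∫⁻ x in cube s, F x) ∧
      (∀ s ∈ S, ∫⁻ x in cube s, F x ≤ 2 ^ n * L * volume (cube s)) ∧
      ∀ x, (∀ s ∈ S, x ∉ cube s) → ∀ k : ℤ,
        ∫⁻ y in cube (k, cubeIndex k x), F y ≤ L * volume (cube (k, cubeIndex k x)) := by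
  set P : ℤ × (Fin n → ℤ) → Prop := fun s => L * volume (cube s) < ∫⁻ x in cube s, F x with hP
  refine ⟨{s | P s ∧ ∀ x ∈ cube s, ∀ k < s.1, ¬ P (k, cubeIndex k x)}, ?_, ?_, ?_, ?_⟩
  · intro s hs t ht hst
    exact pairwise_disjoint_cube_of_minimal P hs.1 ht.1 hs.2 ht.2 hst
  · exact fun s hs => hs.1.le
  · intro s hs
    obtain ⟨x, hx⟩ := cube_nonempty s
    have h1 : s = (s.1, cubeIndex s.1 x) := Prod.ext rfl (Eq.symm hx)
    -- The parent of a maximal cube is not selected, so its average is at most `L`; its volume is `2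
    -- ^ n` times larger, whence the factor in the upper bound.
    have h2 := hs.2 x hx (s.1 - 1) (by omega)
    rw [hP] at h2
    simp only [not_lt] at h2
    calc ∫⁻ x in cube s, F x ≤ ∫⁻ x in cube (s.1 - 1, cubeIndex (s.1 - 1) x), F x := by
          refine lintegral_mono_set ?_
          conv_lhs => rw [h1]
          exact cube_subset_of_le (by omega) x
      _ ≤ _ := h2
      _ = _ := by rw [volume_cube_pred s.1 _ s.2]; ring
  · intro x hx k
    by_contra! hk
    -- Since `F` has finite integral, no cube of volume above `(∫ F) / L` satisfies `P`. Generations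
    -- satisfying `P` at `x` are thus bounded below, and a least one exists.
    obtain ⟨m, hm⟩ : ∃ m : ℤ, ∀ l ≤ m, ¬ P (l, cubeIndex l x) := by
      have hlim : Tendsto (fun j : ℕ => (2 : ℝ≥0∞) ^ j) atTop (𝓝 ⊤) :=
        ENNReal.tendsto_pow_atTop_nhds_top_iff.2 (by norm_num)
      obtain ⟨j, hj⟩ := ((hlim.eventually (lt_mem_nhds
        (ENNReal.div_lt_top hF hL0)))).exists
      refine ⟨-j, fun l hl h => ?_⟩
      have h3 : L * volume (cube (l, cubeIndex l x)) < ∫⁻ y, F y :=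
        lt_of_lt_of_le h (setLIntegral_le_lintegral _ _)
      have h4 : (2 : ℝ≥0∞) ^ j ≤ volume (cube (l, cubeIndex l x)) := by
        rw [volume_cube, ← ENNReal.ofReal_ofNat, ← ENNReal.ofReal_pow (by norm_num),
          ← ENNReal.ofReal_pow (by positivity)]
        apply ENNReal.ofReal_le_ofReal
        have h5 : (2 : ℝ) ^ j ≤ 2 ^ (-l) := by
          rw [← zpow_natCast]
          exact zpow_le_zpow_right₀ (by norm_num) (by omega)
        refine h5.trans ?_
        refine le_self_pow₀ ?_ hn.ne'
        exact one_le_zpow₀ (by norm_num) (by omega)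
      have h6 : (∫⁻ y, F y) / L < volume (cube (l, cubeIndex l x)) := hj.trans_le h4
      rw [ENNReal.div_lt_iff (Or.inl hL0) (Or.inl hL), mul_comm] at h6
      exact lt_asymm h3 h6
    obtain ⟨k₀, hk₀, hmin⟩ := Int.exists_least_of_bdd (P := fun l => P (l, cubeIndex l x))
      ⟨m, fun l hl => by by_contra! h; exact hm l h.le hl⟩ ⟨k, hk⟩
    refine hx (k₀, cubeIndex k₀ x) ⟨hk₀, fun y hy l hl h => ?_⟩ rfl
    have : cubeIndex l y = cubeIndex l x := cubeIndex_eq_of_le hl.le hy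
    rw [this] at h
    exact absurd (hmin l h) (by simpa using hl)

/-- Continuity of `f` replaces the Lebesgue differentiation theorem: on small cubes around `x` the
values of `‖f‖ₑ` stay near `‖f x‖ₑ`. -/
lemma enorm_le_of_forall_cube {f : EuclideanSpace ℝ (Fin n) → ℂ} (hf : Continuous f) {L : ℝ≥0∞}
    {x : EuclideanSpace ℝ (Fin n)} (h : ∀ k : ℤ,
      ∫⁻ y in cube (k, cubeIndex k x), ‖f y‖ₑ ≤ L * volume (cube (k, cubeIndex k x))) :
    ‖f x‖ₑ ≤ L := by
  by_contra! hlt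
  obtain ⟨c, hc1, hc2⟩ := exists_between hlt
  obtain ⟨ε, hε, hball⟩ := Metric.mem_nhds_iff.1 (hf.enorm.continuousAt.eventually (lt_mem_nhds hc2))
  have hlim : Tendsto (fun j : ℕ => √n * (1 / 2 : ℝ) ^ j) atTop (𝓝 (√n * 0)) :=
    (tendsto_pow_atTop_nhds_zero_of_lt_one (by norm_num) (by norm_num)).const_mul _
  rw [mul_zero] at hlim
  obtain ⟨j, hj⟩ := (hlim.eventually (gt_mem_nhds hε)).exists
  set Q := cube ((j : ℤ), cubeIndex j x)
  have h1 : c * volume Q ≤ ∫⁻ y in Q, ‖f y‖ₑ := by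
    rw [← setLIntegral_const]
    refine setLIntegral_mono' (measurableSet_cube _) fun y hy => ?_
    refine le_of_lt (hball ?_)
    rw [Metric.mem_ball, dist_eq_norm]
    refine (norm_sub_le_of_mem_cube hy (mem_cube_cubeIndex _ _)).trans_lt ?_
    simpa using hj
  have h2 := (ENNReal.mul_le_mul_iff_left (volume_cube_ne_zero _) (volume_cube_ne_top _)).1 (h1.trans (h j))
  exact absurd hc1 (not_lt.2 h2)

end Dyadic

/-! ### Calderón–Zygmund decomposition and the weak (1,1) bound. -/

section CalderonZygmund

variable {n : ℕ}

/-- The Calderón–Zygmund decomposition `f = g + (f - g)` at height `L`. -/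
theorem exists_calderonZygmund_decomposition (hn : 0 < n) {f : EuclideanSpace ℝ (Fin n) → ℂ}
    (hfc : Continuous f) (hf : Integrable f) {L : ℝ≥0∞} (hL0 : L ≠ 0) (hL : L ≠ ⊤) :
    ∃ (S : Set (ℤ × (Fin n → ℤ))) (g : EuclideanSpace ℝ (Fin n) → ℂ), S.PairwiseDisjoint cube ∧
      Integrable g ∧ (∀ x, ‖g x‖ₑ ≤ 2 ^ n * L) ∧ (∫⁻ x, ‖g x‖ₑ ≤ ∫⁻ x, ‖f x‖ₑ) ∧
      (∀ x, (∀ s ∈ S, x ∉ cube s) → g x = f x) ∧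
      (∀ s ∈ S, ∫ x in cube s, g x = ∫ x in cube s, f x) ∧
      (∀ s ∈ S, ∫⁻ x in cube s, ‖g x‖ₑ ≤ ∫⁻ x in cube s, ‖f x‖ₑ) ∧
      ∑' s : S, L * volume (cube s.1) ≤ ∫⁻ x, ‖f x‖ₑ := by
  classical
  obtain ⟨S, hdis, hlow, hup, hout⟩ := exists_stopping_cubes hn (fun x => ‖f x‖ₑ) hf.2.ne hL0 hL
  set Q : S → Set (EuclideanSpace ℝ (Fin n)) := fun s => cube s.1
  have hQm : ∀ s, MeasurableSet (Q s) := fun s => measurableSet_cube _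
  have hQd : Pairwise (Function.onFun Disjoint Q) := fun s t hst =>
    hdis s.2 t.2 (fun h => hst (Subtype.ext h))
  -- The good part is the average of `f` on each selected cube and `f` elsewhere, so `f - g` has
  -- mean zero on every cube.
  set a : ℤ × (Fin n → ℤ) → ℂ := fun s => ⨍ x in cube s, f x
  set g : EuclideanSpace ℝ (Fin n) → ℂ := fun x => if h : ∃ s ∈ S, x ∈ cube s then a h.choose else f x
  have hg1 : ∀ s ∈ S, ∀ x ∈ cube s, g x = a s := by
    intro s hs x hx
    have h : ∃ s ∈ S, x ∈ cube s := ⟨s, hs, hx⟩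
    have : h.choose = s := by
      by_contra hne
      exact Set.disjoint_left.1 (hdis h.choose_spec.1 hs hne) h.choose_spec.2 hx
    simp only [g, dif_pos h, this]
  have hg2 : ∀ x, (∀ s ∈ S, x ∉ cube s) → g x = f x := by
    intro x hx
    have h : ¬ ∃ s ∈ S, x ∈ cube s := by push Not; exact hx
    simp only [g, dif_neg h]
  have ha : ∀ s, ‖a s‖ₑ * volume (cube s) ≤ ∫⁻ x in cube s, ‖f x‖ₑ := by
    intro s
    have h1 : a s = (volume.real (cube s))⁻¹ • ∫ x in cube s, f x := setAverage_eq _ _ _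
    have h2 : ‖(volume.real (cube s))⁻¹‖ₑ * volume (cube s) = 1 := by
      rw [enorm_inv (by simp [Measure.real, ENNReal.toReal_eq_zero_iff, volume_cube_ne_zero, volume_cube_ne_top]),
        Real.enorm_of_nonneg measureReal_nonneg,
        ofReal_measureReal (volume_cube_ne_top s)]
      exact ENNReal.inv_mul_cancel (volume_cube_ne_zero s) (volume_cube_ne_top s)
    rw [h1, enorm_smul, mul_right_comm, h2, one_mul]
    exact enorm_integral_le_lintegral_enorm _
  have hgs : ∀ s ∈ S, ∫⁻ x in cube s, ‖g x‖ₑ ≤ ∫⁻ x in cube s, ‖f x‖ₑ := by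
    intro s hs
    refine le_trans (le_of_eq ?_) (ha s)
    rw [← setLIntegral_const]
    exact setLIntegral_congr_fun (measurableSet_cube s) fun x hx => by simp only [hg1 s hs x hx]
  have hUm : MeasurableSet (⋃ s, Q s) := MeasurableSet.iUnion hQm
  have hgm : AEStronglyMeasurable g := by
    have h1 : AEStronglyMeasurable g (volume.restrict (⋃ s, Q s)) := by
      rw [aestronglyMeasurable_iUnion_iff]
      intro s
      refine (aestronglyMeasurable_const (b := a s.1)).congr ?_
      exact (ae_restrict_iff' (hQm s)).2 (ae_of_all _ fun x hx => (hg1 s.1 s.2 x hx).symm)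
    have h2 : AEStronglyMeasurable g (volume.restrict (⋃ s, Q s)ᶜ) := by
      refine (hf.aestronglyMeasurable.restrict).congr ?_
      refine (ae_restrict_iff' hUm.compl).2 (ae_of_all _ fun x hx => (hg2 x fun s hs hxs => ?_).symm)
      exact hx (mem_iUnion.2 ⟨⟨s, hs⟩, hxs⟩)
    have h3 := aestronglyMeasurable_union_iff.2 ⟨h1, h2⟩
    rwa [union_compl_self, Measure.restrict_univ] at h3
  have hgl : ∫⁻ x, ‖g x‖ₑ ≤ ∫⁻ x, ‖f x‖ₑ := by
    rw [← lintegral_add_compl _ hUm, ← lintegral_add_compl (fun x => ‖f x‖ₑ) hUm,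
      lintegral_iUnion hQm hQd, lintegral_iUnion hQm hQd]
    refine add_le_add (ENNReal.tsum_le_tsum fun s => hgs s.1 s.2) (le_of_eq ?_)
    refine setLIntegral_congr_fun hUm.compl fun x hx => ?_
    rw [hg2 x fun s hs hxs => hx (mem_iUnion.2 ⟨⟨s, hs⟩, hxs⟩)]
  refine ⟨S, g, hdis, ⟨hgm, hgl.trans_lt hf.2⟩, ?_, hgl, hg2, ?_, hgs, ?_⟩
  · intro x
    by_cases hx : ∃ s ∈ S, x ∈ cube s
    · obtain ⟨s, hs, hxs⟩ := hx
      rw [hg1 s hs x hxs]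
      exact (ENNReal.mul_le_mul_iff_left (volume_cube_ne_zero s) (volume_cube_ne_top s)).1
        ((ha s).trans (hup s hs))
    · push Not at hx
      rw [hg2 x hx]
      refine (enorm_le_of_forall_cube hfc (hout x hx)).trans ?_
      exact le_mul_of_one_le_left' (one_le_pow₀ (by norm_num))
  · intro s hs
    rw [setIntegral_congr_fun (measurableSet_cube s) (fun x hx => hg1 s hs x hx), setIntegral_const,
      show a s = (volume.real (cube s))⁻¹ • ∫ x in cube s, f x from setAverage_eq _ _ _, smul_smul,
      mul_inv_cancel₀ (by simp [Measure.real, ENNReal.toReal_eq_zero_iff, volume_cube_ne_zero, volume_cube_ne_top]), one_smul]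
  · calc ∑' s : S, L * volume (cube s.1) ≤ ∑' s : S, ∫⁻ x in Q s, ‖f x‖ₑ :=
          ENNReal.tsum_le_tsum fun s => hlow s.1 s.2
      _ = ∫⁻ x in ⋃ s, Q s, ‖f x‖ₑ := (lintegral_iUnion hQm hQd _).symm
      _ ≤ _ := setLIntegral_le_lintegral _ _

lemma eLpNorm_two_sq {E : Type*} [MeasurableSpace E] {μ : Measure E} (f : E → ℂ) :
    eLpNorm f 2 μ ^ 2 = ∫⁻ x, ‖f x‖ₑ ^ 2 ∂μ := by
  have := eLpNorm_nnreal_pow_eq_lintegral (f := f) (μ := μ) (p := 2) (by norm_num)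
  simpa using this

/-- Hörmander's condition recentred at `c`; this is the form needed for a cube of diameter at most
`R` and its dilated ball. -/
lemma IsCZ.lintegral_sub_translate_le {K : 𝓢(EuclideanSpace ℝ (Fin n), ℂ)} {B : ℝ≥0} (hK : IsCZ K B)
    {y c : EuclideanSpace ℝ (Fin n)} {R : ℝ} (hy : ‖y - c‖ ≤ R) :
    ∫⁻ x in (Metric.ball c (2 * R))ᶜ, ‖K (x - y) - K (x - c)‖ₑ ≤ B := by
  refine le_trans ?_ (hK.lintegral_sub_le (y - c))
  have hm : MeasurableSet {x : EuclideanSpace ℝ (Fin n) | 2 * ‖y - c‖ ≤ ‖x‖} :=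
    measurableSet_le (by fun_prop) (by fun_prop)
  rw [← lintegral_indicator hm, ← lintegral_indicator Metric.isOpen_ball.measurableSet.compl,
    ← lintegral_sub_right_eq_self (indicator {x | 2 * ‖y - c‖ ≤ ‖x‖} _) c]
  refine lintegral_mono fun x => ?_
  by_cases hx : x ∈ (Metric.ball c (2 * R))ᶜ
  · rw [indicator_of_mem hx, indicator_of_mem]
    · rw [sub_sub_sub_cancel_right]
    · simp only [mem_compl_iff, Metric.mem_ball, not_lt, dist_eq_norm] at hx
      simp only [mem_ofPred_eq]
      linarith
  · rw [indicator_of_notMem hx]; exact zero_le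

/-- Away from the dilated cubes, the convolution with a function having mean zero on each cube of
a disjoint family is integrable. -/
lemma IsCZ.lintegral_cconv_bad_le {K : 𝓢(EuclideanSpace ℝ (Fin n), ℂ)} {B : ℝ≥0} (hK : IsCZ K B)
    {b : EuclideanSpace ℝ (Fin n) → ℂ} (hb : Integrable b) {S : Set (ℤ × (Fin n → ℤ))}
    (hdis : S.PairwiseDisjoint cube) (hb0 : ∀ x, (∀ s ∈ S, x ∉ cube s) → b x = 0)
    (hmean : ∀ s ∈ S, ∫ x in cube s, b x = 0) (c : ℤ × (Fin n → ℤ) → EuclideanSpace ℝ (Fin n))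
    (hc : ∀ s, c s ∈ cube s) :
    ∫⁻ x in (⋃ s : S, Metric.ball (c s) (2 * (√n * 2 ^ (-s.1.1))))ᶜ, ‖cconv K b x‖ₑ ≤
      B * ∫⁻ x, ‖b x‖ₑ := by
  set Q : S → Set (EuclideanSpace ℝ (Fin n)) := fun s => cube s.1
  have hQm : ∀ s, MeasurableSet (Q s) := fun s => measurableSet_cube _
  have hQd : Pairwise (Function.onFun Disjoint Q) := fun s t hst =>
    hdis s.2 t.2 (fun h => hst (Subtype.ext h))
  have hzero : ∀ x ∉ ⋃ s, Q s, b x = 0 := fun x hx => hb0 x fun s hs hxs =>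
    hx (mem_iUnion.2 ⟨⟨s, hs⟩, hxs⟩)
  have hpt : ∀ x, ‖cconv K b x‖ₑ ≤
      ∑' s : S, ∫⁻ y in Q s, ‖K (x - y) - K (x - c s)‖ₑ * ‖b y‖ₑ := by
    intro x
    have hint := integrable_cconv_integrand K hb x
    have h1 : cconv K b x = ∫ y in ⋃ s, Q s, K (x - y) * b y := by
      rw [cconv, setIntegral_eq_integral_of_forall_compl_eq_zero]
      intro y hy; rw [hzero y hy, mul_zero]
    rw [h1, integral_iUnion hQm hQd hint.integrableOn]
    refine enorm_tsum_le_tsum_enorm.trans (ENNReal.tsum_le_tsum fun s => ?_)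
    -- Mean zero on the cube allows subtracting the constant `K (x - c s)`; this creates the
    -- difference controlled by Hörmander's condition.
    have h2 : ∫ y in Q s, K (x - y) * b y = ∫ y in Q s, (K (x - y) - K (x - c s)) * b y := by
      simp only [sub_mul]
      rw [integral_sub hint.integrableOn (hb.integrableOn.const_mul _), integral_const_mul,
        hmean s.1 s.2, mul_zero, sub_zero]
    rw [h2]
    refine (enorm_integral_le_lintegral_enorm _).trans (le_of_eq ?_)
    simp only [enorm_mul]
  set U := (⋃ s : S, Metric.ball (c s) (2 * (√n * 2 ^ (-s.1.1))))ᶜ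
  have hKc : ∀ c', Continuous fun p : EuclideanSpace ℝ (Fin n) × EuclideanSpace ℝ (Fin n) =>
      ‖K (p.1 - p.2) - K (p.1 - c')‖ₑ := fun c' =>
    ((K.continuous.comp (by fun_prop)).sub (K.continuous.comp (by fun_prop))).enorm
  have hjm : ∀ s : S, AEMeasurable (Function.uncurry fun x y => ‖K (x - y) - K (x - c s)‖ₑ * ‖b y‖ₑ)
      ((volume.restrict U).prod (volume.restrict (Q s))) := fun s =>
    (hKc _).measurable.aemeasurable.mul
      (hb.aestronglyMeasurable.restrict.enorm.comp_quasiMeasurePreserving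
        Measure.quasiMeasurePreserving_snd)
  calc ∫⁻ x in U, ‖cconv K b x‖ₑ
      ≤ ∫⁻ x in U, ∑' s : S, ∫⁻ y in Q s, ‖K (x - y) - K (x - c s)‖ₑ * ‖b y‖ₑ :=
        lintegral_mono fun x => hpt x
    _ = ∑' s : S, ∫⁻ x in U, ∫⁻ y in Q s, ‖K (x - y) - K (x - c s)‖ₑ * ‖b y‖ₑ :=
        lintegral_tsum fun s => (hjm s).lintegral_prod_right'
    _ = ∑' s : S, ∫⁻ y in Q s, ∫⁻ x in U, ‖K (x - y) - K (x - c s)‖ₑ * ‖b y‖ₑ := by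
        congr 1; ext s; exact lintegral_lintegral_swap (hjm s)
    _ ≤ ∑' s : S, ∫⁻ y in Q s, B * ‖b y‖ₑ := by
        refine ENNReal.tsum_le_tsum fun s => setLIntegral_mono' (hQm s) fun y hy => ?_
        rw [lintegral_mul_const' _ _ (by simp)]
        gcongr
        refine le_trans (lintegral_mono_set ?_) (hK.lintegral_sub_translate_le
          (norm_sub_le_of_mem_cube hy (hc s)))
        exact compl_subset_compl.2 (subset_iUnion_of_subset s subset_rfl)
    _ = ∫⁻ y in ⋃ s, Q s, B * ‖b y‖ₑ := (lintegral_iUnion hQm hQd _).symm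
    _ ≤ ∫⁻ y, B * ‖b y‖ₑ := setLIntegral_le_lintegral _ _
    _ = _ := lintegral_const_mul' _ _ (by simp)

lemma volume_ball_eq_mul_cube (hn : 0 < n) (c : EuclideanSpace ℝ (Fin n)) (s : ℤ × (Fin n → ℤ)) :
    volume (Metric.ball c (2 * (√n * 2 ^ (-s.1)))) =
      ENNReal.ofReal ((2 * √n) ^ n) * volume (Metric.ball (0 : EuclideanSpace ℝ (Fin n)) 1) *
        volume (cube s) := by
  have h2 : (0 : ℝ) < 2 ^ (-s.1) := by positivity
  rw [Measure.addHaar_ball_of_pos _ _ (by positivity), volume_cube, finrank_euclideanSpace,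
    Fintype.card_fin, ← mul_assoc 2, mul_pow, ENNReal.ofReal_mul (by positivity),
    ENNReal.ofReal_pow h2.le]
  ring

/-- The weak type `(1,1)` bound. -/
theorem IsCZ.weak_type_one (hn : 0 < n) (B : ℝ≥0) : ∃ C : ℝ≥0,
    ∀ (K : 𝓢(EuclideanSpace ℝ (Fin n), ℂ)), IsCZ K B →
    ∀ f : EuclideanSpace ℝ (Fin n) → ℂ, Continuous f → Integrable f →
    ∀ L : ℝ≥0∞, L ≠ 0 → L ≠ ⊤ →
      L * volume {x | L < ‖cconv K f x‖ₑ} ≤ C * ∫⁻ x, ‖f x‖ₑ := by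
  set D := ENNReal.ofReal ((2 * √n) ^ n) * volume (Metric.ball (0 : EuclideanSpace ℝ (Fin n)) 1)
  have hD : D ≠ ⊤ := ENNReal.mul_ne_top ENNReal.ofReal_ne_top measure_ball_lt_top.ne
  -- The three terms come from the exceptional set `U` (balls comparable to the cubes), from
  -- Chebyshev in `L²` at height `L / 2` for the good part, and from Chebyshev in `L¹` off `U` for
  -- the bad part, whose norm is at most `2 * I`.
  refine ⟨D.toNNReal + 4 * B ^ 2 * 2 ^ n + 4 * B, fun K hK f hfc hf L hL0 hL => ?_⟩
  obtain ⟨S, g, hdis, hgi, hgb, hgl, hgo, hgm, hgs, hS⟩ :=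
    exists_calderonZygmund_decomposition hn hfc hf hL0 hL
  choose c hc using fun s : ℤ × (Fin n → ℤ) => cube_nonempty s
  set I := ∫⁻ x, ‖f x‖ₑ
  set U := ⋃ s : S, Metric.ball (c s) (2 * (√n * 2 ^ (-s.1.1)))
  have hUm : MeasurableSet U := MeasurableSet.iUnion fun _ => Metric.isOpen_ball.measurableSet
  have hbi : Integrable (fun x => f x - g x) := hf.sub hgi
  have hbad : ∫⁻ x in Uᶜ, ‖cconv K (fun x => f x - g x) x‖ₑ ≤ B * (2 * I) := by
    refine (hK.lintegral_cconv_bad_le hbi hdis (fun x hx => by rw [hgo x hx, sub_self])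
      (fun s hs => by rw [integral_sub hf.integrableOn hgi.integrableOn, hgm s hs, sub_self])
      c hc).trans ?_
    gcongr
    calc ∫⁻ x, ‖f x - g x‖ₑ ≤ ∫⁻ x, (‖f x‖ₑ + ‖g x‖ₑ) := lintegral_mono fun x => enorm_sub_le
      _ = I + ∫⁻ x, ‖g x‖ₑ := lintegral_add_left' hf.aestronglyMeasurable.enorm _
      _ ≤ 2 * I := by rw [two_mul]; gcongr
  have hsplit : {x | L < ‖cconv K f x‖ₑ} ⊆ U ∪ ({x | L / 2 ≤ ‖cconv K g x‖ₑ} ∪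
      (Uᶜ ∩ {x | L / 2 ≤ ‖cconv K (fun x => f x - g x) x‖ₑ})) := by
    intro x hx
    by_contra hcon
    simp only [mem_union, mem_inter_iff, mem_compl_iff, mem_ofPred_eq, not_or, not_and, not_le] at hcon
    obtain ⟨h1, h2, h3⟩ := hcon
    have h4 := cconv_add K hgi hbi x
    simp only [add_sub_cancel] at h4
    have : ‖cconv K f x‖ₑ < L := by
      rw [h4]
      refine (enorm_add_le _ _).trans_lt ?_
      rw [← ENNReal.add_halves L]
      exact ENNReal.add_lt_add h2 (h3 h1)
    exact lt_asymm this hx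
  have hU : L * volume U ≤ D * I := by
    calc L * volume U ≤ L * ∑' s : S, D * volume (cube s.1) := by
          gcongr
          refine (measure_iUnion_le _).trans (le_of_eq ?_)
          congr 1; ext s; exact volume_ball_eq_mul_cube hn _ _
      _ = D * ∑' s : S, L * volume (cube s.1) := by
          rw [ENNReal.tsum_mul_left, ENNReal.tsum_mul_left]; ring
      _ ≤ _ := by gcongr
  have hg2 : ∫⁻ x, ‖g x‖ₑ ^ 2 ≤ 2 ^ n * L * I := by
    calc ∫⁻ x, ‖g x‖ₑ ^ 2 ≤ ∫⁻ x, 2 ^ n * L * ‖g x‖ₑ := lintegral_mono fun x => by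
          rw [sq]; gcongr; exact hgb x
      _ = 2 ^ n * L * ∫⁻ x, ‖g x‖ₑ := lintegral_const_mul' _ _ (by finiteness)
      _ ≤ _ := by gcongr
  have hgood : L * volume {x | L / 2 ≤ ‖cconv K g x‖ₑ} ≤ 4 * B ^ 2 * 2 ^ n * I := by
    have hg2' : MemLp g 2 := by
      refine ⟨hgi.aestronglyMeasurable, ?_⟩
      have : eLpNorm g 2 volume ^ 2 < ⊤ := by
        rw [eLpNorm_two_sq]
        exact hg2.trans_lt (ENNReal.mul_lt_top (by finiteness) hf.2)
      simpa using this
    have h1 : ∫⁻ x, ‖cconv K g x‖ₑ ^ 2 ≤ B ^ 2 * ∫⁻ x, ‖g x‖ₑ ^ 2 := by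
      rw [← eLpNorm_two_sq, ← eLpNorm_two_sq, ← mul_pow]
      gcongr
      exact hK.eLpNorm_two_le hgi hg2'
    have h2 := mul_meas_ge_le_lintegral₀ (μ := volume) (f := fun x => ‖cconv K g x‖ₑ ^ 2)
      ((continuous_cconv K hgi).enorm.measurable.pow_const 2).aemeasurable ((L / 2) ^ 2)
    have h3 : {x | (L / 2) ^ 2 ≤ ‖cconv K g x‖ₑ ^ 2} = {x | L / 2 ≤ ‖cconv K g x‖ₑ} := by
      ext x; simp only [mem_ofPred_eq]; exact ENNReal.pow_le_pow_left_iff (by norm_num)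
    rw [h3] at h2
    have h4 := (h2.trans h1).trans (mul_le_mul_right hg2 ((B : ℝ≥0∞) ^ 2))
    have h5 : L ^ 2 = 4 * (L / 2) ^ 2 := by
      conv_lhs => rw [← ENNReal.add_halves L]
      ring
    rw [← ENNReal.mul_le_mul_iff_right hL0 hL]
    set v := volume {x | L / 2 ≤ ‖cconv K g x‖ₑ}
    calc L * (L * v) = 4 * ((L / 2) ^ 2 * v) := by rw [← mul_assoc, ← sq, h5]; ring
      _ ≤ 4 * (B ^ 2 * (2 ^ n * L * I)) := by gcongr
      _ = _ := by ring
  have hb : L * volume (Uᶜ ∩ {x | L / 2 ≤ ‖cconv K (fun x => f x - g x) x‖ₑ}) ≤ 4 * B * I := by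
    have h1 := mul_meas_ge_le_lintegral₀ (μ := volume.restrict Uᶜ)
      (f := fun x => ‖cconv K (fun x => f x - g x) x‖ₑ)
      (continuous_cconv K hbi).enorm.aemeasurable (L / 2)
    rw [Measure.restrict_apply₀' hUm.compl.nullMeasurableSet, inter_comm] at h1
    set v := volume (Uᶜ ∩ {x | L / 2 ≤ ‖cconv K (fun x => f x - g x) x‖ₑ})
    calc L * v = 2 * (L / 2 * v) := by
          conv_lhs => rw [← ENNReal.add_halves L]
          ring
      _ ≤ 2 * (B * (2 * I)) := by gcongr 2 * ?_; exact h1.trans hbad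
      _ = _ := by ring
  calc L * volume {x | L < ‖cconv K f x‖ₑ} ≤ L * (volume U + (volume {x | L / 2 ≤ ‖cconv K g x‖ₑ} +
      volume (Uᶜ ∩ {x | L / 2 ≤ ‖cconv K (fun x => f x - g x) x‖ₑ}))) := by
        gcongr
        refine (measure_mono hsplit).trans ((measure_union_le _ _).trans ?_)
        gcongr
        exact measure_union_le _ _
    _ ≤ D * I + (4 * B ^ 2 * 2 ^ n * I + 4 * B * I) := by
        rw [mul_add, mul_add]
        gcongr
    _ = _ := by
        push_cast
        rw [ENNReal.coe_toNNReal hD]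
        ring

end CalderonZygmund

/-! ### One-variable integrals and truncations for real interpolation. -/

section Interpolation

lemma lintegral_Ioc_rpow {a r : ℝ} (ha : 0 ≤ a) (hr : -1 < r) :
    ∫⁻ t in Ioc 0 a, ENNReal.ofReal (t ^ r) = ENNReal.ofReal (a ^ (r + 1) / (r + 1)) := by
  have hi : IntegrableOn (fun t : ℝ => t ^ r) (Ioc 0 a) := by
    rw [← intervalIntegrable_iff_integrableOn_Ioc_of_le ha]
    exact intervalIntegral.intervalIntegrable_rpow' hr
  rw [← ofReal_integral_eq_lintegral_ofReal hi, ← intervalIntegral.integral_of_le ha,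
    integral_rpow (Or.inl hr), Real.zero_rpow (by linarith), sub_zero]
  exact (ae_restrict_iff' measurableSet_Ioc).2 (ae_of_all _ fun t ht => Real.rpow_nonneg ht.1.le _)

lemma lintegral_Ioi_rpow {a r : ℝ} (ha : 0 < a) (hr : r < -1) :
    ∫⁻ t in Ioi a, ENNReal.ofReal (t ^ r) = ENNReal.ofReal (a ^ (r + 1) / (-(r + 1))) := by
  rw [← ofReal_integral_eq_lintegral_ofReal (integrableOn_Ioi_rpow_of_lt hr ha),
    integral_Ioi_rpow_of_lt hr ha]
  · congr 1; rw [div_neg, neg_div]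
  · exact (ae_restrict_iff' measurableSet_Ioi).2
      (ae_of_all _ fun t ht => Real.rpow_nonneg (ha.trans ht).le _)

/-- Splitting at `t = a` gives `a ^ p / p` and `a ^ p / (2 - p)`; convergence at infinity is where
`p < 2` is needed. This serves the part of `f` truncated at height `t`, treated in `L²`. -/
lemma lintegral_min_sq_mul_rpow_le {a p : ℝ} (ha : 0 ≤ a) (hp1 : 1 < p) (hp2 : p < 2) :
    ∫⁻ t in Ioi (0 : ℝ), ENNReal.ofReal ((min t a) ^ 2 * t ^ (p - 3)) ≤
      ENNReal.ofReal (1 / p + 1 / (2 - p)) * ENNReal.ofReal (a ^ p) := by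
  rcases ha.eq_or_lt with rfl | ha'
  · refine le_trans (le_of_eq ?_) zero_le
    rw [setLIntegral_congr_fun (g := fun _ => 0) measurableSet_Ioi]
    · simp
    · intro t ht
      simp [min_eq_right (le_of_lt (mem_Ioi.1 ht))]
  rw [← Ioc_union_Ioi_eq_Ioi ha, lintegral_union measurableSet_Ioi
    (Set.disjoint_left.2 fun t h1 h2 => absurd h1.2 (not_le.2 h2))]
  have h1 : ∫⁻ t in Ioc 0 a, ENNReal.ofReal ((min t a) ^ 2 * t ^ (p - 3)) =
      ENNReal.ofReal (a ^ p / p) := by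
    have := lintegral_Ioc_rpow ha (r := p - 1) (by linarith)
    rw [sub_add_cancel] at this
    rw [← this]
    refine setLIntegral_congr_fun measurableSet_Ioc fun t ht => ?_
    rw [min_eq_left ht.2, ← Real.rpow_natCast, ← Real.rpow_add ht.1]
    congr 2; push_cast; ring
  have h2 : ∫⁻ t in Ioi a, ENNReal.ofReal ((min t a) ^ 2 * t ^ (p - 3)) =
      ENNReal.ofReal (a ^ p / (2 - p)) := by
    have := lintegral_Ioi_rpow ha' (r := p - 3) (by linarith)
    have h3 : ∫⁻ t in Ioi a, ENNReal.ofReal ((min t a) ^ 2 * t ^ (p - 3)) =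
      ∫⁻ t in Ioi a, ENNReal.ofReal (a ^ 2) * ENNReal.ofReal (t ^ (p - 3)) := by
      refine setLIntegral_congr_fun measurableSet_Ioi fun t ht => ?_
      rw [min_eq_right (le_of_lt ht), ENNReal.ofReal_mul (by positivity)]
    rw [h3, lintegral_const_mul' _ _ (by simp), this, ← ENNReal.ofReal_mul (by positivity)]
    congr 1
    rw [← mul_div_assoc, ← Real.rpow_natCast, ← Real.rpow_add ha']
    congr 2
    · push_cast; ring
    · ring
  rw [h1, h2, ← ENNReal.ofReal_add (by positivity) (div_nonneg (by positivity) (by linarith)),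
    ← ENNReal.ofReal_mul (add_nonneg (by positivity) (one_div_nonneg.2 (by linarith)))]
  apply le_of_eq; congr 1; ring

/-- The integrand vanishes beyond `a`, and convergence at zero is where `1 < p` is needed. This
serves the excess over height `t`, treated by the weak bound. -/
lemma lintegral_sub_min_mul_rpow_le {a p : ℝ} (ha : 0 ≤ a) (hp1 : 1 < p) :
    ∫⁻ t in Ioi (0 : ℝ), ENNReal.ofReal ((a - min t a) * t ^ (p - 2)) ≤
      ENNReal.ofReal (1 / (p - 1)) * ENNReal.ofReal (a ^ p) := by
  rw [← Ioc_union_Ioi_eq_Ioi ha, lintegral_union measurableSet_Ioi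
    (Set.disjoint_left.2 fun t h1 h2 => absurd h1.2 (not_le.2 h2))]
  have h2 : ∫⁻ t in Ioi a, ENNReal.ofReal ((a - min t a) * t ^ (p - 2)) = 0 := by
    rw [setLIntegral_congr_fun (g := fun _ => 0) measurableSet_Ioi]
    · simp
    · intro t ht
      simp [min_eq_right (le_of_lt (mem_Ioi.1 ht))]
  have h1 : ∫⁻ t in Ioc 0 a, ENNReal.ofReal ((a - min t a) * t ^ (p - 2)) ≤
      ∫⁻ t in Ioc 0 a, ENNReal.ofReal a * ENNReal.ofReal (t ^ (p - 2)) := by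
    refine setLIntegral_mono' measurableSet_Ioc fun t ht => ?_
    rw [← ENNReal.ofReal_mul ha]
    have := ht.1
    gcongr
    rw [min_eq_left ht.2]; linarith
  rw [h2, add_zero]
  refine h1.trans (le_of_eq ?_)
  rw [lintegral_const_mul' _ _ (by simp), lintegral_Ioc_rpow ha (by linarith),
    ← ENNReal.ofReal_mul ha, ← ENNReal.ofReal_mul (by rw [one_div_nonneg]; linarith)]
  congr 1
  rcases ha.eq_or_lt with rfl | ha'
  · rw [Real.zero_rpow (by linarith : p ≠ 0)]; ring
  · have h3 : a ^ p = a * a ^ (p - 2 + 1) := by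
      rw [← Real.rpow_one_add' ha (by linarith)]; congr 1; ring
    rw [h3, show p - 2 + 1 = p - 1 by ring]; ring

/-- Radial truncation of a complex number at modulus `t`. -/
noncomputable def trunc (t : ℝ) (z : ℂ) : ℂ := ((t / max t ‖z‖ : ℝ) : ℂ) * z

lemma continuous_trunc {t : ℝ} (ht : 0 < t) : Continuous (trunc t) := by
  unfold trunc
  have : ∀ z : ℂ, max t ‖z‖ ≠ 0 := fun z => (lt_max_of_lt_left ht).ne'
  fun_prop (disch := exact this _)

lemma norm_trunc {t : ℝ} (ht : 0 < t) (z : ℂ) : ‖trunc t z‖ = min t ‖z‖ := by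
  have h := lt_max_of_lt_left (c := ‖z‖) ht
  rw [trunc, norm_mul, Complex.norm_real, Real.norm_of_nonneg (by positivity)]
  rcases le_total t ‖z‖ with h1 | h1
  · rw [max_eq_right h1, min_eq_left h1, div_mul_cancel₀]; rw [max_eq_right h1] at h; exact h.ne'
  · rw [max_eq_left h1, min_eq_right h1, div_self ht.ne', one_mul]

lemma norm_sub_trunc {t : ℝ} (ht : 0 < t) (z : ℂ) : ‖z - trunc t z‖ = ‖z‖ - min t ‖z‖ := by
  have h := lt_max_of_lt_left (c := ‖z‖) ht
  have h2 : z - trunc t z = ((1 - t / max t ‖z‖ : ℝ) : ℂ) * z := by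
    rw [trunc]; push_cast; ring
  have h3 : t / max t ‖z‖ ≤ 1 := by rw [div_le_one h]; exact le_max_left _ _
  rw [h2, norm_mul, Complex.norm_real, Real.norm_of_nonneg (by linarith), sub_mul, one_mul]
  congr 1
  rw [← norm_trunc ht, trunc, norm_mul, Complex.norm_real, Real.norm_of_nonneg (by positivity)]

end Interpolation

/-! ### `L^p` bounds for exponents below two. -/

section LpBounds

lemma lintegral_rpow_lt_top {E : Type*} [MeasurableSpace E] {μ : Measure E} {f : E → ℂ}
    (hf : Integrable f μ) {M : ℝ} (hM : ∀ x, ‖f x‖ ≤ M) {p : ℝ} (hp : 1 ≤ p) :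
    ∫⁻ x, ‖f x‖ₑ ^ p ∂μ < ⊤ := by
  calc ∫⁻ x, ‖f x‖ₑ ^ p ∂μ ≤ ∫⁻ x, ENNReal.ofReal M ^ (p - 1) * ‖f x‖ₑ ∂μ := by
        refine lintegral_mono fun x => ?_
        have h1 : ‖f x‖ₑ ^ p = ‖f x‖ₑ ^ (p - 1) * ‖f x‖ₑ := by
          conv_rhs => rw [← ENNReal.rpow_one (‖f x‖ₑ), ← ENNReal.rpow_mul, one_mul,
            ← ENNReal.rpow_add_of_nonneg _ _ (by linarith) (by norm_num), sub_add_cancel]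
        rw [h1, ← ofReal_norm]
        gcongr
        exact hM x
    _ = ENNReal.ofReal M ^ (p - 1) * ∫⁻ x, ‖f x‖ₑ ∂μ :=
        lintegral_const_mul' _ _ (ENNReal.rpow_ne_top_of_nonneg (by linarith) (by simp))
    _ < ⊤ := ENNReal.mul_lt_top (ENNReal.rpow_lt_top_of_nonneg (by linarith) (by simp)) hf.2

lemma IsCZ.lintegral_sq_le {E : Type*} [NormedAddCommGroup E] [InnerProductSpace ℝ E]
    [FiniteDimensional ℝ E] [MeasurableSpace E] [BorelSpace E] {K : 𝓢(E, ℂ)} {B : ℝ≥0}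
    (hK : IsCZ K B) {f : E → ℂ} (hf : Integrable f) {M : ℝ} (hM : ∀ x, ‖f x‖ ≤ M) :
    ∫⁻ x, ‖cconv K f x‖ₑ ^ 2 ≤ B ^ 2 * ∫⁻ x, ‖f x‖ₑ ^ 2 := by
  have h2 : MemLp f 2 := by
    refine ⟨hf.aestronglyMeasurable, ?_⟩
    have : eLpNorm f 2 volume ^ 2 < ⊤ := by
      rw [eLpNorm_two_sq]
      simpa using lintegral_rpow_lt_top hf hM (p := 2) (by norm_num)
    simpa using this
  rw [← eLpNorm_two_sq, ← eLpNorm_two_sq, ← mul_pow]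
  gcongr
  exact hK.eLpNorm_two_le hf h2

variable {n : ℕ}

/-- Marcinkiewicz interpolation between weak (1,1) and `L²`, splitting `f` at the same height `t` as
the level set. Radial truncation keeps both pieces continuous, as the weak bound demands. -/
theorem IsCZ.lintegral_rpow_le_of_lt_two (hn : 0 < n) (B : ℝ≥0) {p : ℝ} (hp1 : 1 < p) (hp2 : p < 2) :
    ∃ C : ℝ≥0, ∀ (K : 𝓢(EuclideanSpace ℝ (Fin n), ℂ)), IsCZ K B →
    ∀ f : EuclideanSpace ℝ (Fin n) → ℂ, Continuous f → Integrable f →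
      ∫⁻ x, ‖cconv K f x‖ₑ ^ p ≤ C * ∫⁻ x, ‖f x‖ₑ ^ p := by
  obtain ⟨C₁, hC₁⟩ := IsCZ.weak_type_one hn B
  refine ⟨((2 : ℝ≥0∞) ^ p * ENNReal.ofReal p * (B ^ 2 * ENNReal.ofReal (1 / p + 1 / (2 - p)) +
    C₁ * ENNReal.ofReal (1 / (p - 1)))).toNNReal, fun K hK f hfc hf => ?_⟩
  rw [ENNReal.coe_toNNReal (by finiteness)]
  have hTc := continuous_cconv K hf
  have hlevel : ∀ t : ℝ, 0 < t → volume {x | t < ‖cconv K f x‖ / 2} * ENNReal.ofReal (t ^ (p - 1)) ≤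
      B ^ 2 * (∫⁻ x, ENNReal.ofReal ((min t ‖f x‖) ^ 2 * t ^ (p - 3))) +
        C₁ * ∫⁻ x, ENNReal.ofReal ((‖f x‖ - min t ‖f x‖) * t ^ (p - 2)) := by
    intro t ht
    have hgc : Continuous fun x => trunc t (f x) := (continuous_trunc ht).comp hfc
    have hgi : Integrable fun x => trunc t (f x) := hf.mono hgc.aestronglyMeasurable
      (ae_of_all _ fun x => by rw [norm_trunc ht]; exact min_le_right _ _)
    have hbc : Continuous fun x => f x - trunc t (f x) := hfc.sub hgc
    have hbi : Integrable fun x => f x - trunc t (f x) := hf.sub hgi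
    have hsub : {x | t < ‖cconv K f x‖ / 2} ⊆
        {x | ENNReal.ofReal t ^ 2 ≤ ‖cconv K (fun x => trunc t (f x)) x‖ₑ ^ 2} ∪
        {x | ENNReal.ofReal t < ‖cconv K (fun x => f x - trunc t (f x)) x‖ₑ} := by
      intro x hx
      by_contra hcon
      simp only [mem_union, mem_ofPred_eq, not_or, not_le, not_lt] at hcon hx
      have h4 := cconv_add K hgi hbi x
      simp only [add_sub_cancel] at h4
      have h1 : ‖cconv K (fun x => trunc t (f x)) x‖ ≤ t := by
        have := le_of_lt hcon.1
        rw [ENNReal.pow_le_pow_left_iff (by norm_num), ← ofReal_norm] at this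
        exact (ENNReal.ofReal_le_ofReal_iff ht.le).1 this
      have h2 : ‖cconv K (fun x => f x - trunc t (f x)) x‖ ≤ t := by
        have := hcon.2
        rw [← ofReal_norm] at this
        exact (ENNReal.ofReal_le_ofReal_iff ht.le).1 this
      have h3 := norm_add_le (cconv K (fun x => trunc t (f x)) x)
        (cconv K (fun x => f x - trunc t (f x)) x)
      rw [← h4] at h3
      linarith
    have hA := (mul_meas_ge_le_lintegral₀ (μ := volume)
      ((continuous_cconv K hgi).enorm.measurable.pow_const 2).aemeasurable
      (ENNReal.ofReal t ^ 2)).trans (hK.lintegral_sq_le hgi (M := t)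
        (fun x => by rw [norm_trunc ht]; exact min_le_left _ _))
    have hB := hC₁ K hK _ hbc hbi (ENNReal.ofReal t) (by simpa using ht) (by simp)
    have e1 : ∫⁻ x, ENNReal.ofReal ((min t ‖f x‖) ^ 2 * t ^ (p - 3)) =
        (∫⁻ x, ‖trunc t (f x)‖ₑ ^ 2) * ENNReal.ofReal (t ^ (p - 3)) := by
      rw [← lintegral_mul_const' _ _ (by simp)]
      refine lintegral_congr fun x => ?_
      rw [ENNReal.ofReal_mul (by positivity), ← norm_trunc ht, ENNReal.ofReal_pow (norm_nonneg _),
        ofReal_norm]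
    have e2 : ∫⁻ x, ENNReal.ofReal ((‖f x‖ - min t ‖f x‖) * t ^ (p - 2)) =
        (∫⁻ x, ‖f x - trunc t (f x)‖ₑ) * ENNReal.ofReal (t ^ (p - 2)) := by
      rw [← lintegral_mul_const' _ _ (by simp)]
      refine lintegral_congr fun x => ?_
      rw [← norm_sub_trunc ht, ENNReal.ofReal_mul (norm_nonneg _), ofReal_norm]
    have e3 : ENNReal.ofReal (t ^ (p - 1)) = ENNReal.ofReal t ^ 2 * ENNReal.ofReal (t ^ (p - 3)) := by
      rw [← ENNReal.ofReal_pow ht.le, ← ENNReal.ofReal_mul (by positivity), ← Real.rpow_natCast,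
        ← Real.rpow_add ht]
      congr 2; push_cast; ring
    have e4 : ENNReal.ofReal (t ^ (p - 1)) = ENNReal.ofReal t * ENNReal.ofReal (t ^ (p - 2)) := by
      rw [← ENNReal.ofReal_mul ht.le]
      congr 1
      conv_rhs => rw [← Real.rpow_one_add' ht.le (by linarith)]
      congr 1; ring
    rw [e1, e2, ← mul_assoc, ← mul_assoc]
    refine (mul_le_mul_left (measure_mono hsub) _).trans
      ((mul_le_mul_left (measure_union_le _ _) _).trans ?_)
    rw [add_mul]
    refine add_le_add ?_ ?_
    · rw [e3, ← mul_assoc]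
      refine mul_le_mul_left ?_ _
      rw [mul_comm]; exact hA
    · rw [e4, ← mul_assoc]
      refine mul_le_mul_left ?_ _
      rw [mul_comm]; exact hB
  -- Layer-cake formula for half the convolution: where that half exceeds `t`, one of the two pieces
  -- exceeds `t`. The halving costs `2 ^ p`.
  have hlayer : ∫⁻ x, ‖cconv K f x‖ₑ ^ p = (2 : ℝ≥0∞) ^ p * (ENNReal.ofReal p *
      ∫⁻ t in Ioi (0 : ℝ), volume {x | t < ‖cconv K f x‖ / 2} * ENNReal.ofReal (t ^ (p - 1))) := by
    rw [← lintegral_rpow_eq_lintegral_meas_lt_mul volume (ae_of_all _ fun x => by positivity)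
      (by fun_prop) (by linarith), ← lintegral_const_mul' _ _ (by finiteness)]
    refine lintegral_congr fun x => ?_
    rw [← ENNReal.ofReal_rpow_of_nonneg (by positivity) (by linarith),
      ← ENNReal.mul_rpow_of_nonneg _ _ (by linarith)]
    congr 1
    rw [ENNReal.ofReal_div_of_pos (by norm_num), ofReal_norm, ENNReal.ofReal_ofNat,
      ENNReal.mul_div_cancel (by norm_num) (by norm_num)]
  have hm1 : AEMeasurable (Function.uncurry fun (t : ℝ) x =>
      ENNReal.ofReal ((min t ‖f x‖) ^ 2 * t ^ (p - 3))) ((volume.restrict (Ioi 0)).prod volume) := by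
    have := hfc.measurable
    refine Measurable.aemeasurable ?_
    unfold Function.uncurry
    fun_prop
  have hm2 : AEMeasurable (Function.uncurry fun (t : ℝ) x =>
      ENNReal.ofReal ((‖f x‖ - min t ‖f x‖) * t ^ (p - 2)))
      ((volume.restrict (Ioi 0)).prod volume) := by
    have := hfc.measurable
    refine Measurable.aemeasurable ?_
    unfold Function.uncurry
    fun_prop
  have hfp : ∀ x, ENNReal.ofReal (‖f x‖ ^ p) = ‖f x‖ₑ ^ p := fun x => by
    rw [← ENNReal.ofReal_rpow_of_nonneg (norm_nonneg _) (by linarith), ofReal_norm]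
  rw [hlayer, mul_assoc, mul_assoc]
  gcongr (2 : ℝ≥0∞) ^ p * (ENNReal.ofReal p * ?_)
  calc _ ≤ ∫⁻ t in Ioi (0 : ℝ), (B ^ 2 * (∫⁻ x, ENNReal.ofReal ((min t ‖f x‖) ^ 2 * t ^ (p - 3))) +
        C₁ * ∫⁻ x, ENNReal.ofReal ((‖f x‖ - min t ‖f x‖) * t ^ (p - 2))) :=
        setLIntegral_mono' measurableSet_Ioi fun t ht => hlevel t ht
    _ = B ^ 2 * (∫⁻ t in Ioi (0 : ℝ), ∫⁻ x, ENNReal.ofReal ((min t ‖f x‖) ^ 2 * t ^ (p - 3))) +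
        C₁ * ∫⁻ t in Ioi (0 : ℝ), ∫⁻ x, ENNReal.ofReal ((‖f x‖ - min t ‖f x‖) * t ^ (p - 2)) := by
        have hm3 : AEMeasurable (fun t : ℝ => (B : ℝ≥0∞) ^ 2 *
            ∫⁻ x, ENNReal.ofReal ((min t ‖f x‖) ^ 2 * t ^ (p - 3))) (volume.restrict (Ioi 0)) :=
          hm1.lintegral_prod_right'.const_mul _
        rw [lintegral_add_left' hm3,
          lintegral_const_mul' _ _ (by finiteness), lintegral_const_mul' _ _ (by finiteness)]
    _ = B ^ 2 * (∫⁻ x, ∫⁻ t in Ioi (0 : ℝ), ENNReal.ofReal ((min t ‖f x‖) ^ 2 * t ^ (p - 3))) +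
        C₁ * ∫⁻ x, ∫⁻ t in Ioi (0 : ℝ), ENNReal.ofReal ((‖f x‖ - min t ‖f x‖) * t ^ (p - 2)) := by
        rw [lintegral_lintegral_swap hm1, lintegral_lintegral_swap hm2]
    _ ≤ B ^ 2 * (∫⁻ x, ENNReal.ofReal (1 / p + 1 / (2 - p)) * ‖f x‖ₑ ^ p) +
        C₁ * ∫⁻ x, ENNReal.ofReal (1 / (p - 1)) * ‖f x‖ₑ ^ p := by
        gcongr with x x
        · rw [← hfp]; exact lintegral_min_sq_mul_rpow_le (norm_nonneg _) hp1 hp2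
        · rw [← hfp]; exact lintegral_sub_min_mul_rpow_le (norm_nonneg _) hp1
    _ = _ := by
        rw [lintegral_const_mul' _ _ (by simp), lintegral_const_mul' _ _ (by simp)]
        ring

end LpBounds

/-! ### The adjoint of a convolution operator. -/

section Duality

variable {E : Type*} [NormedAddCommGroup E] [InnerProductSpace ℝ E] [FiniteDimensional ℝ E]
  [MeasurableSpace E] [BorelSpace E]

/-- The reflected kernel `x ↦ K (-x)`. -/
noncomputable def reflectKernel (K : 𝓢(E, ℂ)) : 𝓢(E, ℂ) :=
  compCLMOfContinuousLinearEquiv ℝ (ContinuousLinearEquiv.neg ℝ) K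

lemma reflectKernel_apply (K : 𝓢(E, ℂ)) (x : E) : reflectKernel K x = K (-x) := rfl

/-- The kernel class is closed under adjoints with the same constant, so the bounds below two apply
to the adjoint. -/
lemma IsCZ.reflect {K : 𝓢(E, ℂ)} {B : ℝ≥0} (hK : IsCZ K B) : IsCZ (reflectKernel K) B := by
  constructor
  · intro ξ
    have h1 : (𝓕 (reflectKernel K) : 𝓢(E, ℂ)) ξ = (𝓕 K : 𝓢(E, ℂ)) (-ξ) := by
      rw [fourier_coe, fourier_coe]
      exact Real.fourier_comp_linearIsometry (LinearIsometryEquiv.neg ℝ) (⇑K) ξ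
    rw [h1]
    exact hK.norm_fourier_le _
  · intro y
    refine le_trans (le_of_eq ?_) (hK.lintegral_sub_le (-y))
    have hm : ∀ y : E, MeasurableSet {x : E | 2 * ‖y‖ ≤ ‖x‖} := fun y =>
      measurableSet_le (by fun_prop) (by fun_prop)
    rw [← lintegral_indicator (hm _), ← lintegral_indicator (hm _), ← lintegral_neg_eq_self]
    refine lintegral_congr fun x => ?_
    simp only [indicator, mem_ofPred_eq, norm_neg, reflectKernel_apply]
    congr 4
    · abel
    · simp

/-- Convolution is adjoint to convolution with the reflected kernel. -/
lemma integral_cconv_mul (K : 𝓢(E, ℂ)) {f h : E → ℂ} (hf : Integrable f) (hh : Integrable h) :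
    ∫ x, cconv K f x * h x = ∫ y, f y * cconv (reflectKernel K) h y := by
  obtain ⟨C, hC⟩ := exists_norm_le K
  have hi : Integrable (Function.uncurry fun x y => K (x - y) * f y * h x)
      (volume.prod volume) := by
    have h1 : Integrable (fun z : E × E => h z.1 * f z.2) (volume.prod volume) := hh.mul_prod hf
    have h2 := h1.bdd_mul (c := C) (f := fun z : E × E => K (z.1 - z.2))
      (K.continuous.comp (by fun_prop)).aestronglyMeasurable (ae_of_all _ fun z => hC _)
    refine h2.congr (ae_of_all _ fun z => ?_)
    simp only [Function.uncurry]; ring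
  calc ∫ x, cconv K f x * h x = ∫ x, ∫ y, K (x - y) * f y * h x := by
        simp only [cconv, integral_mul_const]
    _ = ∫ y, ∫ x, K (x - y) * f y * h x := integral_integral_swap hi
    _ = _ := by
        congr 1; ext y
        rw [cconv, ← integral_const_mul]
        congr 1; ext x
        rw [reflectKernel_apply, neg_sub]; ring

end Duality

/-! ### `L^p` bounds for exponents above two, and all cases together. -/

section LpBounds

variable {n : ℕ}

/-- Duality: the conjugate exponent `q` lies in `(1, 2)`, where the reflected kernel is already
bounded. -/
theorem IsCZ.lintegral_rpow_le_of_two_lt (hn : 0 < n) (B : ℝ≥0) {p : ℝ} (hp : 2 < p) :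
    ∃ C : ℝ≥0, ∀ (K : 𝓢(EuclideanSpace ℝ (Fin n), ℂ)), IsCZ K B →
    ∀ f : EuclideanSpace ℝ (Fin n) → ℂ, Continuous f → Integrable f →
      ∫⁻ x, ‖cconv K f x‖ₑ ^ p ≤ C * ∫⁻ x, ‖f x‖ₑ ^ p := by
  have hpq : p.HolderConjugate (p.conjExponent) := Real.HolderConjugate.conjExponent (by linarith)
  set q := p.conjExponent with hq
  have hq2 : q < 2 := by
    rw [hq, Real.conjExponent, div_lt_iff₀ (by linarith)]; linarith
  obtain ⟨C, hC⟩ := IsCZ.lintegral_rpow_le_of_lt_two hn B hpq.symm.lt hq2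
  refine ⟨C ^ (p - 1), fun K hK f hfc hf => ?_⟩
  set F := cconv K f with hF
  have hFc : Continuous F := continuous_cconv K hf
  have hFi : Integrable F := integrable_cconv K hf
  obtain ⟨M, hM⟩ : ∃ M : ℝ, ∀ x, ‖F x‖ ≤ M := by
    obtain ⟨c, hc⟩ := exists_norm_le K
    exact ⟨_, norm_cconv_le K hf hc⟩
  set I := ∫⁻ x, ‖F x‖ₑ ^ p with hI
  set J := ∫⁻ x, ‖f x‖ₑ ^ p
  have hItop : I < ⊤ := lintegral_rpow_lt_top hFi hM (by linarith)
  rcases eq_or_ne I 0 with hI0 | hI0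
  · rw [hI0]; exact zero_le
  -- The extremal dual function: `F * h = ‖F‖ ^ p`, while `‖h‖ ^ q = ‖F‖ ^ p`.
  set h : EuclideanSpace ℝ (Fin n) → ℂ := fun x => ((‖F x‖ ^ (p - 2) : ℝ) : ℂ) * star (F x) with hh
  have hhc : Continuous h := by
    refine (Complex.continuous_ofReal.comp (hFc.norm.rpow_const fun x => Or.inr (by linarith))).mul
      (continuous_star.comp hFc)
  have hhn : ∀ x, ‖h x‖ₑ = ‖F x‖ₑ ^ (p - 1) := by
    intro x
    rw [← ofReal_norm, ← ofReal_norm, ENNReal.ofReal_rpow_of_nonneg (norm_nonneg _) (by linarith), hh]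
    simp only [norm_mul, Complex.norm_real, norm_star]
    rw [Real.norm_of_nonneg (by positivity)]
    congr 1
    rw [← Real.rpow_add_one' (norm_nonneg _) (by linarith)]
    congr 1; ring
  have hhi : Integrable h := by
    refine ⟨hhc.aestronglyMeasurable, ?_⟩
    have := lintegral_rpow_lt_top hFi hM (p := p - 1) (by linarith)
    simpa only [HasFiniteIntegral, hhn] using this
  have hFh : ∀ x, F x * h x = ((‖F x‖ ^ p : ℝ) : ℂ) := by
    intro x
    have h1 : F x * star (F x) = ((‖F x‖ ^ 2 : ℝ) : ℂ) := by
      rw [Complex.star_def, Complex.mul_conj, Complex.normSq_eq_norm_sq]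
    calc F x * h x = ((‖F x‖ ^ (p - 2) : ℝ) : ℂ) * (F x * star (F x)) := by rw [hh]; ring
      _ = _ := by
        rw [h1, ← Complex.ofReal_mul, ← Real.rpow_natCast, ← Real.rpow_add' (norm_nonneg _)]
        · congr 2; push_cast; ring
        · push_cast; linarith
  have hIle : I ≤ ∫⁻ y, ‖f y‖ₑ * ‖cconv (reflectKernel K) h y‖ₑ := by
    have h1 : I = ‖∫ x, F x * h x‖ₑ := by
      simp only [hFh]
      rw [integral_complex_ofReal, ← ofReal_norm, Complex.norm_real, Real.norm_of_nonneg
        (integral_nonneg fun x => by positivity), integral_eq_lintegral_of_nonneg_ae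
        (ae_of_all _ fun x => by positivity)
        (hFc.norm.rpow_const fun x => Or.inr (by linarith)).aestronglyMeasurable]
      have h2 : ∫⁻ x, ENNReal.ofReal (‖F x‖ ^ p) = I := lintegral_congr fun x => by
        rw [← ENNReal.ofReal_rpow_of_nonneg (norm_nonneg _) (by linarith), ofReal_norm]
      rw [h2, ENNReal.ofReal_toReal hItop.ne]
    rw [h1, hF, integral_cconv_mul K hf hhi]
    refine (enorm_integral_le_lintegral_enorm _).trans (le_of_eq ?_)
    simp only [enorm_mul]
  have hIq : ∫⁻ x, ‖h x‖ₑ ^ q = I := lintegral_congr fun x => by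
    rw [hhn, ← ENNReal.rpow_mul]
    congr 1
    exact hpq.sub_one_mul_conj
  have hHolder := ENNReal.lintegral_mul_le_Lp_mul_Lq volume hpq
    hfc.enorm.measurable.aemeasurable (continuous_cconv (reflectKernel K) hhi).enorm.measurable.aemeasurable
  have hbound : (∫⁻ y, ‖cconv (reflectKernel K) h y‖ₑ ^ q) ^ (1 / q) ≤ (C * I) ^ (1 / q) := by
    refine ENNReal.rpow_le_rpow ?_ (by have := hpq.symm.pos; positivity)
    have := hC _ hK.reflect h hhc hhi
    rwa [hIq] at this
  have hchain : I ≤ J ^ (1 / p) * (C * I) ^ (1 / q) :=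
    hIle.trans (hHolder.trans (mul_le_mul_right hbound _))
  have hppos : 0 < p := by linarith
  have hqpos : 0 < q := hpq.symm.pos
  have hsplit : I = I ^ (1 / p) * I ^ (1 / q) := by
    rw [← ENNReal.rpow_add _ _ hI0 hItop.ne, one_div, one_div, hpq.inv_add_inv_eq_one,
      ENNReal.rpow_one]
  rw [ENNReal.mul_rpow_of_nonneg _ _ (by positivity), ← mul_assoc] at hchain
  conv_lhs at hchain => rw [hsplit]
  -- Dividing by `I ^ (1 / q)` is legitimate because `I` is nonzero and finite, `F` being bounded
  -- and integrable.
  have hcancel : I ^ (1 / p) ≤ J ^ (1 / p) * (C : ℝ≥0∞) ^ (1 / q) :=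
    (ENNReal.mul_le_mul_iff_left (by
      rw [Ne, ENNReal.rpow_eq_zero_iff]; simp [hI0, hItop.ne])
      (ENNReal.rpow_ne_top_of_nonneg (by positivity) hItop.ne)).1 hchain
  have hfin := ENNReal.rpow_le_rpow hcancel hppos.le
  rw [ENNReal.mul_rpow_of_nonneg _ _ hppos.le, ← ENNReal.rpow_mul, ← ENNReal.rpow_mul,
    ← ENNReal.rpow_mul, one_div_mul_cancel hppos.ne', ENNReal.rpow_one, ENNReal.rpow_one] at hfin
  have he : 1 / q * p = p - 1 := by
    rw [hq, Real.conjExponent]; field_simp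
  rw [he] at hfin
  rw [ENNReal.coe_rpow_of_nonneg _ (by linarith), mul_comm]
  exact hfin

/-- Convolution with a Calderón–Zygmund kernel is bounded on `L^p`, uniformly in the kernel. -/
theorem IsCZ.eLpNorm_le (hn : 0 < n) (B : ℝ≥0) {p : ℝ≥0∞} (hp1 : 1 < p) (hp : p < ⊤) :
    ∃ C : ℝ≥0, ∀ (K : 𝓢(EuclideanSpace ℝ (Fin n), ℂ)), IsCZ K B →
    ∀ f : EuclideanSpace ℝ (Fin n) → ℂ, Continuous f → Integrable f → (∃ M : ℝ, ∀ x, ‖f x‖ ≤ M) →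
      eLpNorm (cconv K f) p volume ≤ C * eLpNorm f p volume := by
  have hp0 : p ≠ 0 := (zero_lt_one.trans hp1).ne'
  have hp1' : 1 < p.toReal := by
    rw [← ENNReal.toReal_one]; exact (ENNReal.toReal_lt_toReal (by simp) hp.ne).2 hp1
  have key : ∃ C : ℝ≥0, ∀ (K : 𝓢(EuclideanSpace ℝ (Fin n), ℂ)), IsCZ K B →
      ∀ f : EuclideanSpace ℝ (Fin n) → ℂ, Continuous f → Integrable f → (∃ M : ℝ, ∀ x, ‖f x‖ ≤ M) →
      ∫⁻ x, ‖cconv K f x‖ₑ ^ p.toReal ≤ C * ∫⁻ x, ‖f x‖ₑ ^ p.toReal := by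
    rcases lt_trichotomy p.toReal 2 with h | h | h
    · obtain ⟨C, hC⟩ := IsCZ.lintegral_rpow_le_of_lt_two hn B hp1' h
      exact ⟨C, fun K hK f hfc hf _ => hC K hK f hfc hf⟩
    · refine ⟨B ^ 2, fun K hK f hfc hf ⟨M, hM⟩ => ?_⟩
      rw [h]
      simpa using hK.lintegral_sq_le hf hM
    · obtain ⟨C, hC⟩ := IsCZ.lintegral_rpow_le_of_two_lt hn B h
      exact ⟨C, fun K hK f hfc hf _ => hC K hK f hfc hf⟩
  obtain ⟨C, hC⟩ := key
  refine ⟨C ^ (1 / p.toReal), fun K hK f hfc hf hM => ?_⟩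
  rw [eLpNorm_eq_lintegral_rpow_enorm_toReal hp0 hp.ne, eLpNorm_eq_lintegral_rpow_enorm_toReal hp0 hp.ne,
    ENNReal.coe_rpow_of_nonneg _ (by positivity), ← ENNReal.mul_rpow_of_nonneg _ _ (by positivity)]
  exact ENNReal.rpow_le_rpow (hC K hK f hfc hf hM) (by positivity)

end LpBounds

/-! ### Schwartz kernels approximating a homogeneous multiplier. -/

section Kernels

variable {E : Type*} [NormedAddCommGroup E] [InnerProductSpace ℝ E] [FiniteDimensional ℝ E]
  [MeasurableSpace E] [BorelSpace E]

/-- Fundamental theorem of calculus along the segment from `x` to `x - y`, then Tonelli and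
translation invariance. Useful for small `y`. -/
lemma lintegral_enorm_sub_translate_le (κ : 𝓢(E, ℂ)) (y : E) :
    ∫⁻ x, ‖κ (x - y) - κ x‖ₑ ≤ ‖y‖ₑ * ∫⁻ x, ‖fderiv ℝ κ x‖ₑ := by
  have hdc : Continuous (fderiv ℝ κ) := (κ.smooth 1).continuous_fderiv (by norm_num)
  have hpt : ∀ x, ‖κ (x - y) - κ x‖ₑ ≤ ∫⁻ t in Ioc (0 : ℝ) 1, ‖y‖ₑ * ‖fderiv ℝ κ (x - t • y)‖ₑ := by
    intro x
    have hd : ∀ t ∈ uIcc (0 : ℝ) 1, HasDerivAt (fun t : ℝ => κ (x - t • y))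
        (fderiv ℝ κ (x - t • y) (-y)) t := by
      intro t _
      have h1 : HasDerivAt (fun t : ℝ => x - t • y) (-y) t := by
        simpa using ((hasDerivAt_id t).smul_const y).const_sub x
      exact (κ.differentiable.differentiableAt.hasFDerivAt).comp_hasDerivAt t h1
    have hc : Continuous fun t : ℝ => fderiv ℝ κ (x - t • y) (-y) :=
      (hdc.comp (by fun_prop)).clm_apply continuous_const
    have h2 := intervalIntegral.integral_eq_sub_of_hasDerivAt hd (hc.intervalIntegrable _ _)
    simp only [one_smul, zero_smul, sub_zero] at h2
    rw [← h2, intervalIntegral.integral_of_le zero_le_one]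
    refine (enorm_integral_le_lintegral_enorm _).trans (lintegral_mono fun t => ?_)
    rw [mul_comm]
    refine (ContinuousLinearMap.le_opENorm _ _).trans ?_
    rw [enorm_neg]
  have hm : AEMeasurable (Function.uncurry fun x (t : ℝ) => ‖y‖ₑ * ‖fderiv ℝ κ (x - t • y)‖ₑ)
      ((volume : Measure E).prod (volume.restrict (Ioc (0 : ℝ) 1))) := by
    have : Continuous fun z : E × ℝ => ‖fderiv ℝ κ (z.1 - z.2 • y)‖ₑ :=
      (hdc.comp (by fun_prop)).enorm
    exact this.measurable.aemeasurable.const_mul _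
  calc ∫⁻ x, ‖κ (x - y) - κ x‖ₑ
      ≤ ∫⁻ x, ∫⁻ t in Ioc (0 : ℝ) 1, ‖y‖ₑ * ‖fderiv ℝ κ (x - t • y)‖ₑ := lintegral_mono hpt
    _ = ∫⁻ t in Ioc (0 : ℝ) 1, ∫⁻ x, ‖y‖ₑ * ‖fderiv ℝ κ (x - t • y)‖ₑ := lintegral_lintegral_swap hm
    _ = ∫⁻ t in Ioc (0 : ℝ) 1, ‖y‖ₑ * ∫⁻ x, ‖fderiv ℝ κ x‖ₑ := by
        refine lintegral_congr fun t => ?_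
        rw [lintegral_const_mul' _ _ (by simp),
          lintegral_sub_right_eq_self (fun x => ‖fderiv ℝ κ x‖ₑ)]
    _ = _ := by simp

/-- On this region both `x` and `x - y` have norm at least `‖y‖`, so the first moment of `κ` gains a
factor `‖y‖⁻¹`. Useful for large `y`. -/
lemma setLIntegral_enorm_sub_translate_le (κ : 𝓢(E, ℂ)) {y : E} (hy : y ≠ 0) :
    ∫⁻ x in {x | 2 * ‖y‖ ≤ ‖x‖}, ‖κ (x - y) - κ x‖ₑ ≤
      ‖y‖ₑ⁻¹ * (2 * ∫⁻ x, ‖x‖ₑ * ‖κ x‖ₑ) := by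
  have hm : MeasurableSet {x : E | 2 * ‖y‖ ≤ ‖x‖} := measurableSet_le (by fun_prop) (by fun_prop)
  have hy0 : ‖y‖ₑ ≠ 0 := by simpa using hy
  have hy1 : ‖y‖ₑ ≠ ⊤ := by simp
  have hmul : ∀ x : E, ‖y‖ ≤ ‖x‖ → ‖κ x‖ₑ ≤ ‖y‖ₑ⁻¹ * (‖x‖ₑ * ‖κ x‖ₑ) := by
    intro x hx
    rw [← mul_assoc]
    refine le_mul_of_one_le_left' ?_
    have : ‖y‖ₑ ≤ ‖x‖ₑ := enorm_le_iff_norm_le.2 hx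
    calc (1 : ℝ≥0∞) = ‖y‖ₑ⁻¹ * ‖y‖ₑ := (ENNReal.inv_mul_cancel hy0 hy1).symm
      _ ≤ _ := by gcongr
  have hc : Continuous fun x : E => ‖x‖ₑ * ‖κ x‖ₑ := by
    have : (fun x : E => ‖x‖ₑ * ‖κ x‖ₑ) = fun x : E => ‖(‖x‖ : ℂ) * κ x‖ₑ := by
      ext x; rw [enorm_mul]; simp [← ofReal_norm]
    rw [this]
    exact (Continuous.mul (by fun_prop) κ.continuous).enorm
  calc ∫⁻ x in {x | 2 * ‖y‖ ≤ ‖x‖}, ‖κ (x - y) - κ x‖ₑ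
      ≤ ∫⁻ x in {x | 2 * ‖y‖ ≤ ‖x‖}, ‖y‖ₑ⁻¹ * (‖x - y‖ₑ * ‖κ (x - y)‖ₑ + ‖x‖ₑ * ‖κ x‖ₑ) := by
        refine setLIntegral_mono' hm fun x hx => ?_
        rw [mul_add]
        have hx' : 2 * ‖y‖ ≤ ‖x‖ := hx
        refine enorm_sub_le.trans (add_le_add (hmul _ ?_) (hmul _ ?_))
        · have := norm_sub_norm_le x y; linarith
        · have := norm_nonneg y; linarith
    _ ≤ ∫⁻ x, ‖y‖ₑ⁻¹ * (‖x - y‖ₑ * ‖κ (x - y)‖ₑ + ‖x‖ₑ * ‖κ x‖ₑ) := setLIntegral_le_lintegral _ _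
    _ = _ := by
        rw [lintegral_const_mul' _ _ (by simpa using hy), lintegral_add_right _ hc.measurable,
          lintegral_sub_right_eq_self (fun x => ‖x‖ₑ * ‖κ x‖ₑ), two_mul]

lemma exists_hormander_bound (κ : 𝓢(E, ℂ)) : ∃ C : ℝ≥0, ∀ y : E, y ≠ 0 →
    ∫⁻ x in {x | 2 * ‖y‖ ≤ ‖x‖}, ‖κ (x - y) - κ x‖ₑ ≤ C * min ‖y‖ₑ ‖y‖ₑ⁻¹ := by
  have h1 : ∫⁻ x, ‖fderiv ℝ κ x‖ₑ ≠ ⊤ := (SchwartzMap.fderivCLM ℝ E ℂ κ).integrable.2.ne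
  have h2 : 2 * ∫⁻ x, ‖x‖ₑ * ‖κ x‖ₑ ≠ ⊤ := by
    have := (κ.integrable_pow_mul volume 1).2.ne
    refine ENNReal.mul_ne_top (by simp) ?_
    convert this using 3 with x
    simp only [pow_one]
    rw [enorm_mul, enorm_norm, enorm_norm]
  refine ⟨max (∫⁻ x, ‖fderiv ℝ κ x‖ₑ).toNNReal (2 * ∫⁻ x, ‖x‖ₑ * ‖κ x‖ₑ).toNNReal, fun y hy => ?_⟩
  rw [ENNReal.coe_max, ENNReal.coe_toNNReal h1, ENNReal.coe_toNNReal h2]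
  rcases le_total ‖y‖ₑ ‖y‖ₑ⁻¹ with h | h
  · rw [min_eq_left h]
    refine (setLIntegral_le_lintegral _ _).trans ((lintegral_enorm_sub_translate_le κ y).trans ?_)
    rw [mul_comm]
    exact mul_le_mul_left (le_max_left _ _) _
  · rw [min_eq_right h]
    refine (setLIntegral_enorm_sub_translate_le κ hy).trans ?_
    rw [mul_comm]
    exact mul_le_mul_left (le_max_right _ _) _

/-- The `L¹`-normalised dilation `x ↦ t ^ dim E * κ (t x)`. -/
noncomputable def dilate (κ : 𝓢(E, ℂ)) (t : ℝˣ) : 𝓢(E, ℂ) :=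
  ((t : ℝ) ^ Module.finrank ℝ E) •
    compCLMOfContinuousLinearEquiv ℝ (ContinuousLinearEquiv.smulLeft (R₁ := ℝ) (M₁ := E) t) κ

lemma dilate_apply (κ : 𝓢(E, ℂ)) (t : ℝˣ) (x : E) :
    dilate κ t x = ((t : ℝ) ^ Module.finrank ℝ E) • κ ((t : ℝ) • x) := rfl

lemma fourier_dilate (κ : 𝓢(E, ℂ)) (t : ℝˣ) (ht : 0 < (t : ℝ)) (ξ : E) :
    (𝓕 (dilate κ t) : 𝓢(E, ℂ)) ξ = (𝓕 κ : 𝓢(E, ℂ)) ((t : ℝ)⁻¹ • ξ) := by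
  rw [fourier_coe, fourier_coe, Real.fourier_eq, Real.fourier_eq]
  have h := Measure.integral_comp_smul volume
    (fun y : E => Real.fourierChar (-inner ℝ y ((t : ℝ)⁻¹ • ξ)) • κ y) (t : ℝ)
  have hp : (0 : ℝ) < (t : ℝ) ^ Module.finrank ℝ E := by positivity
  rw [abs_of_pos (inv_pos.2 hp)] at h
  have h2 : ∫ y : E, Real.fourierChar (-inner ℝ y ((t : ℝ)⁻¹ • ξ)) • κ y =
      (t : ℝ) ^ Module.finrank ℝ E • ∫ x : E, Real.fourierChar (-inner ℝ ((t : ℝ) • x) ((t : ℝ)⁻¹ • ξ)) • κ ((t : ℝ) • x) := by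
    rw [h, smul_smul, mul_inv_cancel₀ hp.ne', one_smul]
  rw [h2, ← integral_smul]
  congr 1; ext x
  rw [dilate_apply, inner_smul_left, inner_smul_right, conj_trivial, mul_inv_cancel_left₀ ht.ne', smul_comm]

/-- Hörmander's integral is scale invariant: dilating the kernel only rescales `y`. -/
lemma lintegral_dilate_sub_le (κ : 𝓢(E, ℂ)) (t : ℝˣ) (ht : 0 < (t : ℝ)) (y : E) :
    ∫⁻ x in {x | 2 * ‖y‖ ≤ ‖x‖}, ‖dilate κ t (x - y) - dilate κ t x‖ₑ =
      ∫⁻ x in {x | 2 * ‖(t : ℝ) • y‖ ≤ ‖x‖}, ‖κ (x - (t : ℝ) • y) - κ x‖ₑ := by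
  have hm : ∀ y : E, MeasurableSet {x : E | 2 * ‖y‖ ≤ ‖x‖} := fun y =>
    measurableSet_le (by fun_prop) (by fun_prop)
  rw [← lintegral_indicator (hm _), ← lintegral_indicator (hm _)]
  set G := indicator {x | 2 * ‖(t : ℝ) • y‖ ≤ ‖x‖} fun x => ‖κ (x - (t : ℝ) • y) - κ x‖ₑ with hG
  have hGm : Measurable G := by
    refine Measurable.indicator ?_ (hm _)
    exact ((κ.continuous.comp (by fun_prop)).sub κ.continuous).enorm.measurable
  have hp : (0 : ℝ) < (t : ℝ) ^ Module.finrank ℝ E := by positivity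
  have h1 : ∫⁻ x, G ((t : ℝ) • x) = ENNReal.ofReal ((t : ℝ) ^ Module.finrank ℝ E)⁻¹ * ∫⁻ x, G x := by
    rw [← lintegral_map hGm (measurable_const_smul _), Measure.map_addHaar_smul _ ht.ne',
      lintegral_smul_measure, abs_of_pos (inv_pos.2 hp), smul_eq_mul]
  have h2 : ∫⁻ x, G x = ∫⁻ x, ENNReal.ofReal ((t : ℝ) ^ Module.finrank ℝ E) * G ((t : ℝ) • x) := by
    rw [lintegral_const_mul' _ _ (by simp), h1, ← mul_assoc, ← ENNReal.ofReal_mul hp.le,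
      mul_inv_cancel₀ hp.ne', ENNReal.ofReal_one, one_mul]
  rw [h2]
  refine lintegral_congr fun x => ?_
  have hiff : 2 * ‖(t : ℝ) • y‖ ≤ ‖(t : ℝ) • x‖ ↔ 2 * ‖y‖ ≤ ‖x‖ := by
    rw [norm_smul, norm_smul, Real.norm_of_nonneg ht.le, mul_left_comm, mul_le_mul_iff_right₀ ht]
  by_cases hx : 2 * ‖y‖ ≤ ‖x‖
  · rw [hG, indicator_of_mem (show x ∈ {x | 2 * ‖y‖ ≤ ‖x‖} from hx), indicator_of_mem (show _ ∈ {x | _ ≤ ‖x‖} from hiff.2 hx),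
      dilate_apply, dilate_apply, ← smul_sub, ← smul_sub, enorm_smul, Real.enorm_of_nonneg hp.le]
  · rw [hG, indicator_of_notMem (show x ∉ {x | 2 * ‖y‖ ≤ ‖x‖} from hx), indicator_of_notMem
      (show _ ∉ {x | _ ≤ ‖x‖} from fun h => hx (hiff.1 h)), mul_zero]

/-- With `2 ^ k ≤ s < 2 ^ (k + 1)`, the `j`-th term is at most `2 * 2 ^ (-|j + k|)`; this two-sided
geometric series has a sum independent of the shift `k`. -/
lemma exists_sum_min_zpow_le : ∃ C : ℝ, 0 ≤ C ∧ ∀ (F : Finset ℤ) (s : ℝ), 0 < s →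
    ∑ j ∈ F, min ((2 : ℝ) ^ j * s) ((2 : ℝ) ^ j * s)⁻¹ ≤ C := by
  set a : ℤ → ℝ := fun i => 2 * (1 / 2 : ℝ) ^ i.natAbs with ha
  have hs : Summable a := by
    refine Summable.mul_left _ (Summable.of_nat_of_neg ?_ ?_) <;>
    · simp only [Int.natAbs_neg, Int.natAbs_natCast]
      exact summable_geometric_of_lt_one (by norm_num) (by norm_num)
  refine ⟨∑' i, a i, tsum_nonneg fun i => by positivity, fun F s hs0 => ?_⟩
  obtain ⟨k, hk1, hk2⟩ := exists_mem_Ico_zpow (x := s) (y := (2 : ℝ)) hs0 (by norm_num)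
  have hle : ∀ j : ℤ, min ((2 : ℝ) ^ j * s) ((2 : ℝ) ^ j * s)⁻¹ ≤ a (j + k) := by
    intro j
    have h2j : (0 : ℝ) < 2 ^ j := by positivity
    have e1 : (2 : ℝ) ^ j * s ≤ 2 * 2 ^ (j + k) := by
      calc (2 : ℝ) ^ j * s ≤ 2 ^ j * 2 ^ (k + 1) := by gcongr
        _ = _ := by rw [zpow_add₀ (by norm_num), zpow_add₀ (by norm_num)]; ring
    have e2 : ((2 : ℝ) ^ j * s)⁻¹ ≤ 2 ^ (-(j + k)) := by
      rw [zpow_neg, zpow_add₀ (by norm_num)]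
      gcongr
    rw [ha]
    simp only
    rcases le_total 0 (j + k) with h | h
    · refine (min_le_right _ _).trans (e2.trans ?_)
      obtain ⟨l, hl⟩ := Int.eq_ofNat_of_zero_le h
      rw [hl, zpow_neg, Int.natAbs_natCast, one_div, inv_pow, zpow_natCast]
      have : (0 : ℝ) < (2 ^ l)⁻¹ := by positivity
      linarith
    · refine (min_le_left _ _).trans (e1.trans ?_)
      obtain ⟨l, hl⟩ := Int.eq_ofNat_of_zero_le (neg_nonneg.2 h)
      rw [show j + k = -(l : ℤ) by omega, zpow_neg, Int.natAbs_neg, Int.natAbs_natCast, one_div, inv_pow, zpow_natCast]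
  calc ∑ j ∈ F, min ((2 : ℝ) ^ j * s) ((2 : ℝ) ^ j * s)⁻¹ ≤ ∑ j ∈ F, a (j + k) :=
        Finset.sum_le_sum fun j _ => hle j
    _ ≤ ∑' j, a (j + k) := Summable.sum_le_tsum _ (fun j _ => by positivity)
        ((Equiv.addRight k).summable_iff.2 hs)
    _ = ∑' i, a i := (Equiv.addRight k).tsum_eq a

/-- The scaling factor `2 ^ j` as a unit. -/
noncomputable def twoZpow (j : ℤ) : ℝˣ := Units.mk0 ((2 : ℝ) ^ j) (by positivity)

@[simp] lemma coe_twoZpow (j : ℤ) : (twoZpow j : ℝ) = 2 ^ j := rfl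

/-- The sum of the dyadic dilates of `κ`. -/
noncomputable def dyadicSum (κ : 𝓢(E, ℂ)) (J : ℕ) : 𝓢(E, ℂ) :=
  ∑ j ∈ Finset.Icc (-(J : ℤ)) J, dilate κ (twoZpow j)

lemma dyadicSum_apply (κ : 𝓢(E, ℂ)) (J : ℕ) (x : E) :
    dyadicSum κ J x = ∑ j ∈ Finset.Icc (-(J : ℤ)) J, dilate κ (twoZpow j) x := by
  rw [dyadicSum, sum_apply]

lemma fourier_dyadicSum (κ : 𝓢(E, ℂ)) (J : ℕ) (ξ : E) :
    (𝓕 (dyadicSum κ J) : 𝓢(E, ℂ)) ξ =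
      ∑ j ∈ Finset.Icc (-(J : ℤ)) J, (𝓕 κ : 𝓢(E, ℂ)) ((2 : ℝ) ^ (-j) • ξ) := by
  have : (𝓕 (dyadicSum κ J) : 𝓢(E, ℂ)) =
      ∑ j ∈ Finset.Icc (-(J : ℤ)) J, (𝓕 (dilate κ (twoZpow j)) : 𝓢(E, ℂ)) := by
    rw [dyadicSum]
    exact map_sum (FourierTransform.fourierCLM ℂ 𝓢(E, ℂ)) _ _
  rw [this, sum_apply]
  refine Finset.sum_congr rfl fun j _ => ?_
  rw [fourier_dilate _ _ (by simp; positivity), coe_twoZpow, zpow_neg]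

/-- After rescaling, the `j`-th dilate contributes the smaller of `2 ^ j * ‖y‖` and its inverse, so
the sum stays bounded uniformly in `J` and `y`. -/
lemma exists_hormander_dyadicSum (κ : 𝓢(E, ℂ)) : ∃ B : ℝ≥0, ∀ (J : ℕ) (y : E),
    ∫⁻ x in {x | 2 * ‖y‖ ≤ ‖x‖}, ‖dyadicSum κ J (x - y) - dyadicSum κ J x‖ₑ ≤ B := by
  obtain ⟨C, hC⟩ := exists_hormander_bound κ
  obtain ⟨D, hD0, hD⟩ := exists_sum_min_zpow_le
  refine ⟨C * D.toNNReal, fun J y => ?_⟩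
  rcases eq_or_ne y 0 with rfl | hy
  · simp
  have hy' : 0 < ‖y‖ := norm_pos_iff.2 hy
  calc ∫⁻ x in {x | 2 * ‖y‖ ≤ ‖x‖}, ‖dyadicSum κ J (x - y) - dyadicSum κ J x‖ₑ
      ≤ ∫⁻ x in {x | 2 * ‖y‖ ≤ ‖x‖}, ∑ j ∈ Finset.Icc (-(J : ℤ)) J,
          ‖dilate κ (twoZpow j) (x - y) - dilate κ (twoZpow j) x‖ₑ := by
        refine lintegral_mono fun x => ?_
        rw [dyadicSum_apply, dyadicSum_apply, ← Finset.sum_sub_distrib]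
        exact enorm_sum_le _ _
    _ = ∑ j ∈ Finset.Icc (-(J : ℤ)) J, ∫⁻ x in {x | 2 * ‖y‖ ≤ ‖x‖},
          ‖dilate κ (twoZpow j) (x - y) - dilate κ (twoZpow j) x‖ₑ := by
        refine lintegral_finsetSum _ fun j _ => ?_
        exact (((dilate κ (twoZpow j)).continuous.comp (by fun_prop)).sub
          (dilate κ (twoZpow j)).continuous).enorm.measurable
    _ ≤ ∑ j ∈ Finset.Icc (-(J : ℤ)) J, C * ENNReal.ofReal (min ((2 : ℝ) ^ j * ‖y‖) ((2 : ℝ) ^ j * ‖y‖)⁻¹) := by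
        refine Finset.sum_le_sum fun j _ => ?_
        have h2 : (0 : ℝ) < 2 ^ j := by positivity
        rw [lintegral_dilate_sub_le _ _ (by simpa using h2), coe_twoZpow]
        refine (hC _ (smul_ne_zero h2.ne' hy)).trans (le_of_eq ?_)
        have h3 : ‖(2 : ℝ) ^ j • y‖ₑ = ENNReal.ofReal ((2 : ℝ) ^ j * ‖y‖) := by
          rw [← ofReal_norm, norm_smul, Real.norm_of_nonneg h2.le]
        rw [h3, ENNReal.ofReal_min, ENNReal.ofReal_inv_of_pos (by positivity)]
    _ = C * ENNReal.ofReal (∑ j ∈ Finset.Icc (-(J : ℤ)) J, min ((2 : ℝ) ^ j * ‖y‖) ((2 : ℝ) ^ j * ‖y‖)⁻¹) := by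
        rw [ENNReal.ofReal_sum_of_nonneg fun j _ => by positivity, Finset.mul_sum]
    _ ≤ C * ENNReal.ofReal D := by gcongr; exact hD _ _ hy'
    _ = _ := by rw [ENNReal.coe_mul]; rfl

/-- A fixed smooth bump function, equal to `1` on the unit ball and supported in the ball of
radius `2`. -/
noncomputable def bump (E : Type*) [NormedAddCommGroup E] : ContDiffBump (0 : E) :=
  ⟨1, 2, by norm_num, by norm_num⟩

/-- The cutoff to the annulus `2 ^ (-J) ≲ ‖ξ‖ ≲ 2 ^ J`. -/
noncomputable def annulusCutoff (J : ℕ) (ξ : E) : ℂ :=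
  ((bump E ((2 : ℝ) ^ (-(J : ℤ)) • ξ) - bump E ((2 : ℝ) ^ ((J : ℤ) + 1) • ξ) : ℝ) : ℂ)

lemma norm_annulusCutoff_le (J : ℕ) (ξ : E) : ‖annulusCutoff J ξ‖ ≤ 1 := by
  rw [annulusCutoff, Complex.norm_real, Real.norm_eq_abs, abs_le]
  have h1 := (bump E).nonneg' ((2 : ℝ) ^ (-(J : ℤ)) • ξ)
  have h2 := (bump E).le_one (x := (2 : ℝ) ^ (-(J : ℤ)) • ξ)
  have h3 := (bump E).nonneg' ((2 : ℝ) ^ ((J : ℤ) + 1) • ξ)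
  have h4 := (bump E).le_one (x := (2 : ℝ) ^ ((J : ℤ) + 1) • ξ)
  constructor <;> linarith

lemma tendsto_annulusCutoff {ξ : E} (hξ : ξ ≠ 0) :
    Tendsto (fun J => annulusCutoff J ξ) atTop (𝓝 1) := by
  have hξ' : 0 < ‖ξ‖ := norm_pos_iff.2 hξ
  have hpow : Tendsto (fun J : ℕ => (2 : ℝ) ^ J) atTop atTop :=
    tendsto_pow_atTop_atTop_of_one_lt (by norm_num)
  refine tendsto_const_nhds.congr' ?_
  filter_upwards [hpow.eventually_ge_atTop ‖ξ‖, hpow.eventually_ge_atTop ‖ξ‖⁻¹] with J h1 h2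
  have h2J : (0 : ℝ) < 2 ^ J := by positivity
  have e1 : bump E ((2 : ℝ) ^ (-(J : ℤ)) • ξ) = 1 := by
    refine (bump E).one_of_mem_closedBall ?_
    rw [mem_closedBall_zero_iff, norm_smul, zpow_neg, zpow_natCast, norm_inv,
      Real.norm_of_nonneg h2J.le, inv_mul_le_iff₀ h2J]
    simpa [bump] using h1
  have e2 : bump E ((2 : ℝ) ^ ((J : ℤ) + 1) • ξ) = 0 := by
    refine (bump E).zero_of_le_dist ?_
    rw [dist_zero_right, norm_smul, Real.norm_of_nonneg (by positivity), zpow_add₀ (by norm_num),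
      zpow_natCast, zpow_one]
    have : 1 ≤ 2 ^ J * ‖ξ‖ := by rwa [inv_le_iff_one_le_mul₀ hξ'] at h2
    simp only [bump]
    linarith
  rw [annulusCutoff, e1, e2]; simp

lemma sum_sub_zpow (u : ℤ → ℂ) (J : ℕ) :
    ∑ j ∈ Finset.Icc (-(J : ℤ)) J, (u j - u (j - 1)) = u J - u (-J - 1) := by
  induction J with
  | zero => simp
  | succ J ih =>
    have h : Finset.Icc (-((J + 1 : ℕ) : ℤ)) ((J + 1 : ℕ) : ℤ) =
        insert ((J : ℤ) + 1) (insert (-(J : ℤ) - 1) (Finset.Icc (-(J : ℤ)) J)) := by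
      ext j; simp only [Finset.mem_Icc, Finset.mem_insert]; omega
    rw [h, Finset.sum_insert (by simp; omega), Finset.sum_insert (by simp), ih]
    push_cast
    rw [show -((J : ℤ) + 1) - 1 = -(J : ℤ) - 1 - 1 by ring, add_sub_cancel_right]
    ring

/-- A bounded multiplier which is smooth away from the origin and homogeneous of degree zero is
approximated by uniformly bounded Calderón–Zygmund convolution operators. -/
theorem exists_kernels {m : E → ℂ} (hsm : ∀ ξ, ξ ≠ 0 → ContDiffAt ℝ ∞ m ξ)
    (hhom : ∀ t : ℝ, 0 < t → ∀ ξ, m (t • ξ) = m ξ) {M : ℝ} (hM : ∀ ξ, ‖m ξ‖ ≤ M) :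
    ∃ (B : ℝ≥0) (K : ℕ → 𝓢(E, ℂ)), (∀ J, IsCZ (K J) B) ∧
      ∀ J ξ, (𝓕 (K J) : 𝓢(E, ℂ)) ξ = m ξ * annulusCutoff J ξ := by
  -- One annular piece of `m`. Both bumps equal one near the origin, so `a` vanishes there and is
  -- smooth despite the singularity of `m`.
  set a : E → ℂ := fun ξ => m ξ * ((bump E ξ - bump E ((2 : ℝ) • ξ) : ℝ) : ℂ) with ha
  have hasupp : HasCompactSupport a := by
    refine HasCompactSupport.intro (isCompact_closedBall (0 : E) 2) fun x hx => ?_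
    have hx' : 2 < ‖x‖ := by simpa using hx
    have e1 : bump E x = 0 := (bump E).zero_of_le_dist (by simp [bump]; linarith)
    have e2 : bump E ((2 : ℝ) • x) = 0 := (bump E).zero_of_le_dist (by
      rw [dist_zero_right, norm_smul, Real.norm_of_nonneg (by norm_num)]; simp only [bump]; linarith)
    rw [ha]; simp only [e1, e2]; simp
  have hasm : ContDiff ℝ ∞ a := by
    rw [contDiff_iff_contDiffAt]
    intro ξ
    rcases eq_or_ne ξ 0 with rfl | hξ
    · refine (contDiffAt_const (c := (0 : ℂ))).congr_of_eventuallyEq ?_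
      filter_upwards [Metric.ball_mem_nhds (0 : E) (by norm_num : (0 : ℝ) < 1 / 2)] with x hx
      have hx' : ‖x‖ < 1 / 2 := by simpa using hx
      have e1 : bump E x = 1 := (bump E).one_of_mem_closedBall (by simp [bump]; linarith)
      have e2 : bump E ((2 : ℝ) • x) = 1 := (bump E).one_of_mem_closedBall (by
        rw [mem_closedBall_zero_iff, norm_smul, Real.norm_of_nonneg (by norm_num)]; simp only [bump]; linarith)
      rw [ha]; simp only [e1, e2]; simp
    · refine (hsm ξ hξ).mul (Complex.ofRealCLM.contDiff.contDiffAt.comp ξ ?_)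
      exact (bump E).contDiff.contDiffAt.sub ((bump E).contDiff.comp (contDiff_const_smul _)).contDiffAt
  set κ : 𝓢(E, ℂ) := 𝓕⁻ (hasupp.toSchwartzMap hasm) with hκ
  have hκa : ∀ ξ, (𝓕 κ : 𝓢(E, ℂ)) ξ = a ξ := by
    intro ξ
    rw [hκ, FourierTransform.fourier_fourierInv_eq]; rfl
  have hF : ∀ J ξ, (𝓕 (dyadicSum κ J) : 𝓢(E, ℂ)) ξ = m ξ * annulusCutoff J ξ := by
    intro J ξ
    rw [fourier_dyadicSum]
    -- Homogeneity pulls `m ξ` out of every dilate; the remaining differences of bumps telescope.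
    have h1 : ∀ j : ℤ, (𝓕 κ : 𝓢(E, ℂ)) ((2 : ℝ) ^ (-j) • ξ) =
        m ξ * ((bump E ((2 : ℝ) ^ (-j) • ξ) : ℂ) - (bump E ((2 : ℝ) ^ (-(j - 1)) • ξ) : ℂ)) := by
      intro j
      rw [hκa, ha]
      simp only
      rw [hhom _ (by positivity), smul_smul]
      congr 1
      push_cast
      congr 5
      rw [neg_sub, sub_eq_add_neg, zpow_add₀ (by norm_num), zpow_one]
    simp only [h1]
    rw [← Finset.mul_sum, sum_sub_zpow (fun j => (bump E ((2 : ℝ) ^ (-j) • ξ) : ℂ)), annulusCutoff,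
      show -(-(J : ℤ) - 1) = J + 1 by ring, Complex.ofReal_sub]
  obtain ⟨B, hB⟩ := exists_hormander_dyadicSum κ
  refine ⟨max M.toNNReal B, fun J => dyadicSum κ J, fun J => ⟨fun ξ => ?_, fun y => ?_⟩, hF⟩
  · rw [hF, norm_mul]
    calc ‖m ξ‖ * ‖annulusCutoff J ξ‖ ≤ ‖m ξ‖ * 1 := by gcongr; exact norm_annulusCutoff_le J ξ
      _ ≤ M := by rw [mul_one]; exact hM ξ
      _ ≤ _ := (Real.le_coe_toNNReal M).trans (by exact_mod_cast le_max_left _ _)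
  · exact (hB J y).trans (by exact_mod_cast le_max_right _ _)

end Kernels

/-! ### Smooth homogeneous reconstruction from constant rank. -/

section Multiplier

variable {E V U W : Type*} [NormedAddCommGroup E] [NormedSpace ℝ E] [FiniteDimensional ℝ E]
  [NormedAddCommGroup V] [InnerProductSpace ℂ V] [FiniteDimensional ℂ V]
  [NormedAddCommGroup U] [InnerProductSpace ℂ U] [FiniteDimensional ℂ U]
  [NormedAddCommGroup W] [InnerProductSpace ℂ W]

/-- `T = D ∘ B⁺`, where `B⁺` is the Moore–Penrose inverse of `B`. -/
structure IsReconstruction (D : V →L[ℂ] W) (B : V →L[ℂ] U) (T : U →L[ℂ] W) : Prop where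
  apply_apply : ∀ v, T (B v) = D v
  apply_eq_zero : ∀ w, (∀ v, inner ℂ (B v) w = 0) → T w = 0

/-- The space `U` is the sum of the range of `B` and its orthogonal complement, and the two
conditions fix the map on each. -/
lemma IsReconstruction.unique {D : V →L[ℂ] W} {B : V →L[ℂ] U} {T T' : U →L[ℂ] W}
    (h : IsReconstruction D B T) (h' : IsReconstruction D B T') : T = T' := by
  ext w
  obtain ⟨y, hy, z, hz, rfl⟩ := (LinearMap.range B.toLinearMap).exists_add_mem_mem_orthogonal w
  obtain ⟨v, rfl⟩ := hy
  have hz' : ∀ v, inner ℂ (B v) z = 0 := fun v =>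
    (Submodule.mem_orthogonal _ _).1 hz _ ⟨v, rfl⟩
  simp only [ContinuousLinearMap.coe_coe, map_add, h.apply_apply, h'.apply_apply,
    h.apply_eq_zero z hz', h'.apply_eq_zero z hz']

lemma isReconstruction_smul {D : V →L[ℂ] W} {B : V →L[ℂ] U} {T : U →L[ℂ] W} {t : ℂ} (ht : t ≠ 0)
    (h : IsReconstruction D B T) : IsReconstruction (t • D) (t • B) T := by
  refine ⟨fun v => by simp [h.apply_apply], fun w hw => h.apply_eq_zero w fun v => ?_⟩
  have := hw v
  simpa [inner_smul_left, ht] using this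

lemma contDiffAt_clm_comp {X Y Z : Type*} [NormedAddCommGroup X] [NormedSpace ℂ X]
    [NormedAddCommGroup Y] [NormedSpace ℂ Y] [NormedAddCommGroup Z] [NormedSpace ℂ Z]
    {f : E → Y →L[ℂ] Z} {g : E → X →L[ℂ] Y} {ξ : E} (hf : ContDiffAt ℝ ∞ f ξ)
    (hg : ContDiffAt ℝ ∞ g ξ) : ContDiffAt ℝ ∞ (fun ξ => f ξ ∘L g ξ) ξ := by
  have h : ContDiff ℂ ∞ fun p : (Y →L[ℂ] Z) × (X →L[ℂ] Y) => p.1 ∘L p.2 :=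
    isBoundedBilinearMap_comp.contDiff
  exact (h.restrict_scalars ℝ).contDiffAt.comp ξ (hf.prodMk hg)

/-- The adjoint is conjugate-linear, hence linear and smooth over the reals only. -/
lemma contDiffAt_adjoint {X Y : Type*} [NormedAddCommGroup X] [InnerProductSpace ℂ X]
    [CompleteSpace X] [NormedAddCommGroup Y] [InnerProductSpace ℂ Y] [CompleteSpace Y]
    {f : E → X →L[ℂ] Y} {ξ : E} (hf : ContDiffAt ℝ ∞ f ξ) :
    ContDiffAt ℝ ∞ (fun ξ => ContinuousLinearMap.adjoint (f ξ)) ξ := by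
  let L : (X →L[ℂ] Y) →L[ℝ] (Y →L[ℂ] X) :=
    AddMonoidHom.toRealLinearMap
      (AddMonoidHom.mk' (fun T : X →L[ℂ] Y => ContinuousLinearMap.adjoint T) (fun S T => map_add _ S T))
      (ContinuousLinearMap.adjoint (𝕜 := ℂ) (E := X) (F := Y)).continuous
  exact L.contDiff.contDiffAt.comp ξ hf

/-- Under a constant rank condition the reconstruction map can be chosen smoothly near a point. -/
lemma exists_smooth_isReconstruction {D : E → V →L[ℂ] W} {B : E → V →L[ℂ] U} {ξ₀ : E}
    (hD : ContDiff ℝ ∞ D) (hB : ContDiff ℝ ∞ B) (hker : ∀ ξ v, B ξ v = 0 ↔ D ξ v = 0)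
    (hrank : ∀ᶠ ξ in 𝓝 ξ₀, Module.finrank ℂ (LinearMap.range (B ξ).toLinearMap) =
      Module.finrank ℂ (LinearMap.range (B ξ₀).toLinearMap)) :
    ∃ T : E → U →L[ℂ] W, ContDiffAt ℝ ∞ T ξ₀ ∧ ∀ᶠ ξ in 𝓝 ξ₀, IsReconstruction (D ξ) (B ξ) (T ξ) := by
  -- On the fixed space `S`, the map `B ξ₀` is injective, so `G ξ` is invertible near `ξ₀`. This
  -- gives the smooth left inverse `G⁻¹ BS*` of `BS`.
  set S : Submodule ℂ V := (LinearMap.ker (B ξ₀).toLinearMap)ᗮ with hS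
  set BS : E → S →L[ℂ] U := fun ξ => B ξ ∘L S.subtypeL with hBS
  set G : E → S →L[ℂ] S := fun ξ => ContinuousLinearMap.adjoint (BS ξ) ∘L BS ξ with hG
  have hBSc : ContDiff ℝ ∞ BS := contDiff_iff_contDiffAt.2 fun ξ =>
    contDiffAt_clm_comp hB.contDiffAt contDiffAt_const
  have hadj : ContDiff ℝ ∞ fun ξ => ContinuousLinearMap.adjoint (BS ξ) :=
    contDiff_iff_contDiffAt.2 fun ξ => contDiffAt_adjoint hBSc.contDiffAt
  have hGc : ContDiff ℝ ∞ G := contDiff_iff_contDiffAt.2 fun ξ =>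
    contDiffAt_clm_comp hadj.contDiffAt hBSc.contDiffAt
  have hG0 : IsUnit (G ξ₀) := by
    rw [ContinuousLinearMap.isUnit_iff_bijective]
    have hinj : Function.Injective (G ξ₀) := by
      rw [injective_iff_map_eq_zero]
      intro s hs
      have h1 : BS ξ₀ s = 0 := by
        have : inner ℂ (BS ξ₀ s) (BS ξ₀ s) = 0 := by
          rw [← ContinuousLinearMap.adjoint_inner_left]
          change inner ℂ (G ξ₀ s) s = 0
          rw [hs, inner_zero_left]
        exact inner_self_eq_zero.1 this
      have h2 : (s : V) ∈ LinearMap.ker (B ξ₀).toLinearMap := h1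
      have h3 : inner ℂ (s : V) (s : V) = 0 := (Submodule.mem_orthogonal _ _).1 s.2 _ h2
      exact Subtype.ext (inner_self_eq_zero.1 h3)
    exact ⟨hinj, (LinearMap.injective_iff_surjective (f := (G ξ₀).toLinearMap)).1 hinj⟩
  have hGu : ∀ᶠ ξ in 𝓝 ξ₀, IsUnit (G ξ) := by
    have h1 : {T : S →L[ℂ] S | IsUnit T} ∈ 𝓝 (G ξ₀) := (Units.isOpen (R := S →L[ℂ] S)).mem_nhds hG0
    filter_upwards [hGc.continuous.continuousAt h1] with ξ h using h
  refine ⟨fun ξ => (D ξ ∘L S.subtypeL) ∘L (Ring.inverse (G ξ) ∘L ContinuousLinearMap.adjoint (BS ξ)),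
    ?_, ?_⟩
  · refine contDiffAt_clm_comp (contDiffAt_clm_comp hD.contDiffAt contDiffAt_const)
      (contDiffAt_clm_comp ?_ hadj.contDiffAt)
    obtain ⟨u, hu⟩ := hG0
    have h1 : ContDiffAt ℂ ∞ Ring.inverse (G ξ₀) := by
      rw [← hu]
      exact contDiffAt_ringInverse (R := S →L[ℂ] S) ℂ u
    exact (h1.restrict_scalars ℝ).comp ξ₀ hGc.contDiffAt
  · filter_upwards [hGu, hrank] with ξ hu hr
    have hinv : ∀ s, Ring.inverse (G ξ) (G ξ s) = s := fun s => by
      have := Ring.inverse_mul_cancel _ hu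
      exact congrArg (fun L : S →L[ℂ] S => L s) this
    have hBSinj : Function.Injective (BS ξ) := by
      intro s s' h
      rw [← hinv s, ← hinv s']
      simp only [hG, ContinuousLinearMap.comp_apply, h]
    have hle : LinearMap.range (BS ξ).toLinearMap ≤ LinearMap.range (B ξ).toLinearMap := by
      rintro _ ⟨s, rfl⟩
      exact ⟨(s : V), rfl⟩
    -- Constant rank enters here: the range of `BS ξ` has dimension `dim S`, the rank of `B ξ₀`,
    -- hence that of `B ξ`, so restricting to `S` loses nothing.
    have hrange : LinearMap.range (BS ξ).toLinearMap = LinearMap.range (B ξ).toLinearMap := by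
      refine Submodule.eq_of_le_of_finrank_eq hle ?_
      rw [LinearMap.finrank_range_of_inj hBSinj, hr]
      have h1 := (B ξ₀).toLinearMap.finrank_range_add_finrank_ker
      have h2 := (LinearMap.ker (B ξ₀).toLinearMap).finrank_add_finrank_orthogonal
      change _ + Module.finrank ℂ S = _ at h2
      omega
    refine ⟨fun v => ?_, fun w hw => ?_⟩
    · obtain ⟨s, hs⟩ : B ξ v ∈ LinearMap.range (BS ξ).toLinearMap := hrange ▸ ⟨v, rfl⟩
      have hs' : BS ξ s = B ξ v := hs
      rw [← hs']
      have h1 : D ξ ((s : V) - v) = 0 := by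
        rw [← hker, map_sub, sub_eq_zero]; exact hs'
      rw [map_sub, sub_eq_zero] at h1
      rw [← h1]
      exact congrArg (fun s : S => D ξ (s : V)) (hinv s)
    · have h1 : ContinuousLinearMap.adjoint (BS ξ) w = 0 := by
        refine ext_inner_left ℂ fun s => ?_
        rw [ContinuousLinearMap.adjoint_inner_right, inner_zero_right]
        exact hw s
      simp [h1]

/-- Existence of a bounded multiplier, smooth away from the origin and homogeneous of degree zero,
which recovers `D ξ v` from `A (D ξ v)`. -/
theorem exists_multiplier [FiniteDimensional ℂ W] {D : E → V →L[ℂ] W} (hD : ContDiff ℝ ∞ D)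
    (hsmul : ∀ (t : ℝ) ξ, D (t • ξ) = (t : ℂ) • D ξ) (A : W →L[ℂ] U)
    (hA : ∀ ξ v, A (D ξ v) = 0 → D ξ v = 0)
    {r : ℕ} (hr : ∀ ξ, ξ ≠ 0 → Module.finrank ℂ (LinearMap.range (D ξ).toLinearMap) = r) :
    ∃ m : E → U →L[ℂ] W, (∀ ξ, ξ ≠ 0 → ContDiffAt ℝ ∞ m ξ) ∧
      (∀ t : ℝ, 0 < t → ∀ ξ, m (t • ξ) = m ξ) ∧ (∃ M : ℝ, ∀ ξ, ‖m ξ‖ ≤ M) ∧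
      ∀ ξ v, m ξ (A (D ξ v)) = D ξ v := by
  classical
  set B : E → V →L[ℂ] U := fun ξ => A ∘L D ξ with hBdef
  have hB : ContDiff ℝ ∞ B := contDiff_iff_contDiffAt.2 fun ξ =>
    contDiffAt_clm_comp contDiffAt_const hD.contDiffAt
  have hker : ∀ ξ v, B ξ v = 0 ↔ D ξ v = 0 := fun ξ v =>
    ⟨hA ξ v, fun h => by simp [hBdef, h]⟩
  have hrB : ∀ ξ, ξ ≠ 0 → Module.finrank ℂ (LinearMap.range (B ξ).toLinearMap) = r := by
    intro ξ hξ
    have hk : LinearMap.ker (B ξ).toLinearMap = LinearMap.ker (D ξ).toLinearMap := by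
      ext v; exact hker ξ v
    have h1 := (B ξ).toLinearMap.finrank_range_add_finrank_ker
    have h2 := (D ξ).toLinearMap.finrank_range_add_finrank_ker
    rw [hk] at h1
    have := hr ξ hξ
    omega
  have hloc : ∀ ξ₀, ξ₀ ≠ 0 → ∃ T : E → U →L[ℂ] W, ContDiffAt ℝ ∞ T ξ₀ ∧
      ∀ᶠ ξ in 𝓝 ξ₀, IsReconstruction (D ξ) (B ξ) (T ξ) := by
    intro ξ₀ h0
    refine exists_smooth_isReconstruction hD hB hker ?_
    filter_upwards [isOpen_ne.mem_nhds h0] with ξ hξ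
    rw [hrB ξ hξ, hrB ξ₀ h0]
  have hex : ∀ ξ, ∃ T, IsReconstruction (D ξ) (B ξ) T := by
    intro ξ
    rcases eq_or_ne ξ 0 with rfl | h0
    · have hD0 : D 0 = 0 := by simpa using hsmul 0 0
      exact ⟨0, fun v => by simp [hD0], fun w _ => by simp⟩
    · obtain ⟨T, -, hT⟩ := hloc ξ h0
      exact ⟨T ξ, hT.self_of_nhds⟩
  choose m hm using hex
  -- The pointwise choice agrees with each local smooth reconstruction by uniqueness, and so
  -- inherits smoothness.
  have hsm : ∀ ξ, ξ ≠ 0 → ContDiffAt ℝ ∞ m ξ := by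
    intro ξ h0
    obtain ⟨T, hTs, hT⟩ := hloc ξ h0
    refine hTs.congr_of_eventuallyEq ?_
    filter_upwards [hT] with η hη
    exact (hm η).unique hη
  have hhom : ∀ t : ℝ, 0 < t → ∀ ξ, m (t • ξ) = m ξ := by
    intro t ht ξ
    have h1 := isReconstruction_smul (t := (t : ℂ)) (by exact_mod_cast ht.ne') (hm ξ)
    have h2 := hm (t • ξ)
    have h3 : B (t • ξ) = (t : ℂ) • B ξ := by
      simp only [hBdef, hsmul, ContinuousLinearMap.comp_smul]
    rw [hsmul, h3] at h2
    exact h2.unique h1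
  refine ⟨m, hsm, hhom, ?_, fun ξ v => (hm ξ).apply_apply v⟩
  -- Continuity on the compact unit sphere and homogeneity bound `m`; only injectivity of `A` on the
  -- ranges was used, not a quantitative lower bound.
  obtain ⟨C, hC⟩ := (isCompact_sphere (0 : E) 1).exists_bound_of_continuousOn (f := m)
    fun ξ hξ => (hsm ξ (by rintro rfl; simp at hξ)).continuousAt.continuousWithinAt
  refine ⟨max C ‖m 0‖, fun ξ => ?_⟩
  rcases eq_or_ne ξ 0 with rfl | h0
  · exact le_max_right _ _
  · have hpos : 0 < ‖ξ‖⁻¹ := inv_pos.2 (norm_pos_iff.2 h0)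
    rw [← hhom _ hpos ξ]
    refine (hC _ ?_).trans (le_max_left _ _)
    simp [norm_smul, h0]

end Multiplier

/-! ### Fourier transform identities and inversion. -/

section FourierIdentities

variable {E : Type*} [NormedAddCommGroup E] [InnerProductSpace ℝ E] [FiniteDimensional ℝ E]
  [MeasurableSpace E] [BorelSpace E]

lemma fourier_clm_comp {V W : Type*} [NormedAddCommGroup V] [NormedSpace ℂ V] [CompleteSpace V]
    [NormedAddCommGroup W] [NormedSpace ℂ W] [CompleteSpace W] (L : V →L[ℂ] W) {f : E → V}
    (hf : Integrable f) (ξ : E) : 𝓕 (fun x => L (f x)) ξ = L (𝓕 f ξ) := by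
  rw [Real.fourier_eq, Real.fourier_eq, ← L.integral_comp_comm]
  · simp [Circle.smul_def]
  · exact (Real.fourierIntegral_convergent_iff ξ).2 hf

lemma fourier_convolution_mul (K f : 𝓢(E, ℂ)) (ξ : E) :
    (𝓕 (SchwartzMap.convolution (ContinuousLinearMap.mul ℂ ℂ) K f) : 𝓢(E, ℂ)) ξ =
      (𝓕 K : 𝓢(E, ℂ)) ξ * (𝓕 f : 𝓢(E, ℂ)) ξ := by
  rw [SchwartzMap.fourier_convolution, pairing_apply_apply]; rfl

/-- Fourier inversion along the annular cutoffs. -/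
lemma tendsto_of_fourier_eq_annulusCutoff [Nontrivial E] (g : 𝓢(E, ℂ)) (Q : ℕ → 𝓢(E, ℂ))
    (hQ : ∀ J ξ, (𝓕 (Q J) : 𝓢(E, ℂ)) ξ = annulusCutoff J ξ * (𝓕 g : 𝓢(E, ℂ)) ξ) (x : E) :
    Tendsto (fun J => Q J x) atTop (𝓝 (g x)) := by
  have hinv : ∀ h : 𝓢(E, ℂ), h x = ∫ ξ, Real.fourierChar (inner ℝ ξ x) • (𝓕 h : 𝓢(E, ℂ)) ξ := by
    intro h
    have h1 : 𝓕⁻ (𝓕 h : 𝓢(E, ℂ)) = h := FourierTransform.fourierInv_fourier_eq h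
    conv_lhs => rw [← h1]
    rw [fourierInv_coe, Real.fourierInv_eq]
  rw [hinv g]
  simp only [hinv (Q _)]
  refine tendsto_integral_of_dominated_convergence (fun ξ => ‖(𝓕 g : 𝓢(E, ℂ)) ξ‖) (fun J => ?_)
    (𝓕 g : 𝓢(E, ℂ)).integrable.norm (fun J => ae_of_all _ fun ξ => ?_) ?_
  · refine Continuous.aestronglyMeasurable ?_
    exact (Real.continuous_fourierChar.comp (by fun_prop)).smul (𝓕 (Q J) : 𝓢(E, ℂ)).continuous
  · rw [Circle.norm_smul, hQ, norm_mul]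
    exact mul_le_of_le_one_left (norm_nonneg _) (norm_annulusCutoff_le J ξ)
  -- The cutoffs converge to one except at the origin, a null set because `E` is nontrivial.
  · have h0 : ∀ᵐ ξ : E, ξ ≠ 0 := Measure.ae_ne volume 0
    filter_upwards [h0] with ξ hξ
    simp only [hQ]
    have := (tendsto_annulusCutoff hξ).mul_const ((𝓕 g : 𝓢(E, ℂ)) ξ)
    rw [one_mul] at this
    exact this.const_smul _

lemma fourier_fderiv_apply {V : Type*} [NormedAddCommGroup V] [NormedSpace ℂ V] [CompleteSpace V]
    (u : 𝓢(E, V)) (e ξ : E) :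
    𝓕 (fun x => fderiv ℝ u x e) ξ = (2 * Real.pi * Complex.I * (inner ℝ ξ e : ℝ)) • 𝓕 (u : E → V) ξ := by
  have h := congrArg (fun f : 𝓢(E, V) => f ξ) (SchwartzMap.fourier_lineDerivOp_eq u e)
  have ht : (inner ℝ · e : E → ℝ).HasTemperateGrowth := by fun_prop
  simp only [smul_apply, smulLeftCLM_apply_apply ht, fourier_coe] at h
  rw [mul_smul, Complex.coe_smul]
  exact h

end FourierIdentities

/-! ### The operator and its symbol on the Fourier side. -/

section DiffOp

variable {n N M K : ℕ}

/-- The factor `2π` of the Fourier convention is kept inside the argument, so that the value is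
visibly in the range of the symbol. -/
lemma fourier_diffOp (Dhat : Fin n → EuclideanSpace ℂ (Fin N) →L[ℂ] EuclideanSpace ℂ (Fin M))
    (u : 𝓢(EuclideanSpace ℝ (Fin n), EuclideanSpace ℂ (Fin N))) (ξ : EuclideanSpace ℝ (Fin n)) :
    𝓕 (diffOp Dhat u) ξ = symbol Dhat ξ ((2 * Real.pi : ℂ) • 𝓕 (u : EuclideanSpace ℝ (Fin n) → _) ξ) := by
  set L : (Fin n → EuclideanSpace ℂ (Fin N)) →L[ℂ] EuclideanSpace ℂ (Fin M) :=
    (-Complex.I) • ∑ j, Dhat j ∘L ContinuousLinearMap.proj j with hL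
  set w : EuclideanSpace ℝ (Fin n) → Fin n → EuclideanSpace ℂ (Fin N) :=
    fun x j => fderiv ℝ u x (EuclideanSpace.single j (1 : ℝ)) with hw
  have hwi : Integrable w := by
    refine Integrable.of_eval fun j => ?_
    exact (LineDeriv.lineDerivOp (EuclideanSpace.single j (1 : ℝ)) u : 𝓢(_, _)).integrable
  have h1 : diffOp Dhat u = fun x => L (w x) := by
    ext1 x
    simp [diffOp, hL, hw]
  have h2 : ∀ j, 𝓕 w ξ j = (2 * Real.pi * Complex.I * (ξ j : ℝ)) • 𝓕 (u : EuclideanSpace ℝ (Fin n) → _) ξ := by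
    intro j
    have := fourier_clm_comp (ContinuousLinearMap.proj j : (Fin n → EuclideanSpace ℂ (Fin N)) →L[ℂ] _) hwi ξ
    simp only [ContinuousLinearMap.proj_apply] at this
    rw [← this, fourier_fderiv_apply]
    simp [EuclideanSpace.inner_single_right]
  rw [h1, fourier_clm_comp L hwi]
  simp only [hL, smul_apply, sum_apply, ContinuousLinearMap.comp_apply,
    ContinuousLinearMap.proj_apply, h2, symbol, Finset.smul_sum, map_smul, smul_smul]
  refine Finset.sum_congr rfl fun j _ => ?_
  congr 1
  linear_combination (-2 * Real.pi * (ξ j : ℂ)) * Complex.I_sq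

lemma contDiff_diffOp (Dhat : Fin n → EuclideanSpace ℂ (Fin N) →L[ℂ] EuclideanSpace ℂ (Fin M))
    {u : EuclideanSpace ℝ (Fin n) → EuclideanSpace ℂ (Fin N)} (hu : ContDiff ℝ ∞ u) :
    ContDiff ℝ ∞ (diffOp Dhat u) := by
  unfold diffOp
  refine ContDiff.const_smul _ (ContDiff.sum fun j _ => ?_)
  exact ((Dhat j).restrictScalars ℝ).contDiff.comp
    ((hu.fderiv_right (m := ∞) (by simp)).clm_apply contDiff_const)

lemma hasCompactSupport_diffOp (Dhat : Fin n → EuclideanSpace ℂ (Fin N) →L[ℂ] EuclideanSpace ℂ (Fin M))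
    {u : EuclideanSpace ℝ (Fin n) → EuclideanSpace ℂ (Fin N)} (hu : HasCompactSupport u) :
    HasCompactSupport (diffOp Dhat u) := by
  have h := hu.fderiv (𝕜 := ℝ)
  refine h.mono fun x hx => ?_
  contrapose! hx
  simp only [Function.mem_support, not_not] at hx ⊢
  simp [diffOp, hx]

lemma contDiff_symbol (Dhat : Fin n → EuclideanSpace ℂ (Fin N) →L[ℂ] EuclideanSpace ℂ (Fin M)) :
    ContDiff ℝ ∞ (symbol Dhat) := by
  unfold symbol
  refine ContDiff.sum fun j _ => ?_
  exact ((ContinuousLinearMap.toSpanSingleton ℂ (Dhat j)).restrictScalars ℝ).contDiff.comp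
    (Complex.ofRealCLM.contDiff.comp (EuclideanSpace.proj (𝕜 := ℝ) j).contDiff)

lemma symbol_smul (Dhat : Fin n → EuclideanSpace ℂ (Fin N) →L[ℂ] EuclideanSpace ℂ (Fin M))
    (t : ℝ) (ξ : EuclideanSpace ℝ (Fin n)) : symbol Dhat (t • ξ) = (t : ℂ) • symbol Dhat ξ := by
  simp [symbol, Finset.smul_sum, smul_smul]

end DiffOp

/-! ### Matrix multipliers on `L^p`, and the theorem. -/

section Main

variable {n M K : ℕ}

/-- If the Fourier transform of `g` is obtained from that of `f` by a bounded matrix multiplier,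
smooth away from the origin and homogeneous of degree zero, then `‖g‖_p ≲ ‖f‖_p`. -/
theorem exists_eLpNorm_le_of_multiplier (hn : 0 < n)
    {m : EuclideanSpace ℝ (Fin n) → EuclideanSpace ℂ (Fin K) →L[ℂ] EuclideanSpace ℂ (Fin M)}
    (hsm : ∀ ξ, ξ ≠ 0 → ContDiffAt ℝ ∞ m ξ) (hhom : ∀ t : ℝ, 0 < t → ∀ ξ, m (t • ξ) = m ξ)
    (hM : ∃ R : ℝ, ∀ ξ, ‖m ξ‖ ≤ R) {p : ℝ≥0∞} (hp1 : 1 < p) (hp : p < ⊤) :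
    ∃ C : ℝ≥0, ∀ (f : EuclideanSpace ℝ (Fin n) → EuclideanSpace ℂ (Fin K))
      (g : EuclideanSpace ℝ (Fin n) → EuclideanSpace ℂ (Fin M)),
      ContDiff ℝ ∞ f → HasCompactSupport f → ContDiff ℝ ∞ g → HasCompactSupport g →
      (∀ ξ, 𝓕 g ξ = m ξ (𝓕 f ξ)) → eLpNorm g p volume ≤ C * eLpNorm f p volume := by
  have : Nonempty (Fin n) := ⟨⟨0, hn⟩⟩
  obtain ⟨R, hR⟩ := hM
  set e : Fin K → EuclideanSpace ℂ (Fin K) := fun b => EuclideanSpace.single b 1 with he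
  have hker : ∀ (a : Fin M) (b : Fin K), ∃ (B : ℝ≥0) (k : ℕ → 𝓢(EuclideanSpace ℝ (Fin n), ℂ)),
      (∀ J, IsCZ (k J) B) ∧ ∀ J ξ, (𝓕 (k J) : 𝓢(EuclideanSpace ℝ (Fin n), ℂ)) ξ =
        m ξ (e b) a * annulusCutoff J ξ := by
    intro a b
    refine exists_kernels (m := fun ξ => m ξ (e b) a) (M := R) (fun ξ hξ => ?_)
      (fun t ht ξ => by rw [hhom t ht]) (fun ξ => ?_)
    · let L : (EuclideanSpace ℂ (Fin K) →L[ℂ] EuclideanSpace ℂ (Fin M)) →L[ℂ] ℂ :=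
        (EuclideanSpace.proj a : EuclideanSpace ℂ (Fin M) →L[ℂ] ℂ) ∘L
          ContinuousLinearMap.apply ℂ (EuclideanSpace ℂ (Fin M)) (e b)
      exact (L.restrictScalars ℝ).contDiff.contDiffAt.comp ξ (hsm ξ hξ)
    · refine (PiLp.norm_apply_le _ a).trans (((m ξ).le_opNorm _).trans ?_)
      simpa [he] using hR ξ
  choose B k hk hkF using hker
  choose C hC using fun (a : Fin M) (b : Fin K) => IsCZ.eLpNorm_le hn (B a b) hp1 hp
  refine ⟨∑ a, ∑ b, C a b, fun f g hf hfs hg hgs hfg => ?_⟩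
  have hfi : Integrable f := hf.continuous.integrable_of_hasCompactSupport hfs
  have hgi : Integrable g := hg.continuous.integrable_of_hasCompactSupport hgs
  have hfbs : ∀ b, HasCompactSupport fun x => f x b := fun b =>
    hfs.comp_left (g := fun v : EuclideanSpace ℂ (Fin K) => v b) rfl
  have hfbc : ∀ b, ContDiff ℝ ∞ fun x => f x b := fun b =>
    ((EuclideanSpace.proj b : EuclideanSpace ℂ (Fin K) →L[ℂ] ℂ).restrictScalars ℝ).contDiff.comp hf
  have hgas : ∀ a, HasCompactSupport fun x => g x a := fun a =>
    hgs.comp_left (g := fun v : EuclideanSpace ℂ (Fin M) => v a) rfl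
  have hgac : ∀ a, ContDiff ℝ ∞ fun x => g x a := fun a =>
    ((EuclideanSpace.proj a : EuclideanSpace ℂ (Fin M) →L[ℂ] ℂ).restrictScalars ℝ).contDiff.comp hg
  set fb : Fin K → 𝓢(EuclideanSpace ℝ (Fin n), ℂ) := fun b => (hfbs b).toSchwartzMap (hfbc b)
  set ga : Fin M → 𝓢(EuclideanSpace ℝ (Fin n), ℂ) := fun a => (hgas a).toSchwartzMap (hgac a)
  have hfbF : ∀ b ξ, (𝓕 (fb b) : 𝓢(EuclideanSpace ℝ (Fin n), ℂ)) ξ = 𝓕 f ξ b := fun b ξ =>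
    fourier_clm_comp (EuclideanSpace.proj b : EuclideanSpace ℂ (Fin K) →L[ℂ] ℂ) hfi ξ
  have hgaF : ∀ a ξ, (𝓕 (ga a) : 𝓢(EuclideanSpace ℝ (Fin n), ℂ)) ξ = 𝓕 g ξ a := fun a ξ =>
    fourier_clm_comp (EuclideanSpace.proj a : EuclideanSpace ℂ (Fin M) →L[ℂ] ℂ) hgi ξ
  have hexp : ∀ a ξ, 𝓕 g ξ a = ∑ b, m ξ (e b) a * 𝓕 f ξ b := by
    intro a ξ
    have h1 : 𝓕 f ξ = ∑ b, 𝓕 f ξ b • e b := by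
      ext i
      simp [he, Pi.single_apply]
    rw [hfg]
    conv_lhs => rw [h1]
    simp [mul_comm]
  have hcomp : ∀ a, eLpNorm (fun x => g x a) p volume ≤ (∑ b, C a b : ℝ≥0) * eLpNorm f p volume := by
    intro a
    -- Each component of `g` is the pointwise limit of these sums of scalar convolutions; their
    -- bounds are uniform in `J`, so Fatou applies.
    set Q : ℕ → 𝓢(EuclideanSpace ℝ (Fin n), ℂ) := fun J =>
      ∑ b, SchwartzMap.convolution (ContinuousLinearMap.mul ℂ ℂ) (k a b J) (fb b) with hQ
    have hQx : ∀ J x, Q J x = ∑ b, cconv (k a b J) (fb b) x := by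
      intro J x
      simp only [hQ, sum_apply, cconv_eq_convolution]
    have hQF : ∀ J ξ, (𝓕 (Q J) : 𝓢(EuclideanSpace ℝ (Fin n), ℂ)) ξ =
        annulusCutoff J ξ * (𝓕 (ga a) : 𝓢(EuclideanSpace ℝ (Fin n), ℂ)) ξ := by
      intro J ξ
      have h1 : (𝓕 (Q J) : 𝓢(EuclideanSpace ℝ (Fin n), ℂ)) =
          ∑ b, (𝓕 (SchwartzMap.convolution (ContinuousLinearMap.mul ℂ ℂ) (k a b J) (fb b)) :
            𝓢(EuclideanSpace ℝ (Fin n), ℂ)) :=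
        map_sum (FourierTransform.fourierCLM ℂ 𝓢(EuclideanSpace ℝ (Fin n), ℂ)) _ _
      rw [h1, sum_apply, hgaF, hexp, Finset.mul_sum]
      refine Finset.sum_congr rfl fun b _ => ?_
      rw [fourier_convolution_mul, hkF, hfbF]; ring
    have hlim : ∀ x, Tendsto (fun J => Q J x) atTop (𝓝 (g x a)) := fun x =>
      tendsto_of_fourier_eq_annulusCutoff (ga a) Q hQF x
    refine (Lp.eLpNorm_lim_le_liminf_eLpNorm (f := fun J => (Q J : EuclideanSpace ℝ (Fin n) → ℂ))
      (fun J => (Q J).continuous.aestronglyMeasurable) _ (ae_of_all _ hlim)).trans ?_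
    refine liminf_le_of_le ⟨0, by simp⟩ fun r hr => ?_
    obtain ⟨J, hJ⟩ := hr.exists
    refine hJ.trans ?_
    have h2 : (Q J : EuclideanSpace ℝ (Fin n) → ℂ) = ∑ b, cconv (k a b J) (fb b) := by
      ext x; rw [hQx, Finset.sum_apply]
    rw [h2, ENNReal.ofNNReal_finsetSum, Finset.sum_mul]
    refine (eLpNorm_sum_le (fun b _ => (continuous_cconv _ (fb b).integrable).aestronglyMeasurable)
      hp1.le).trans (Finset.sum_le_sum fun b _ => ?_)
    refine (hC a b _ (hk a b J) (fb b) (fb b).continuous (fb b).integrable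
      (exists_norm_le (fb b))).trans ?_
    gcongr
    exact eLpNorm_mono fun x => PiLp.norm_apply_le _ b
  have hsum : eLpNorm g p volume ≤ ∑ a, eLpNorm (fun x => g x a) p volume := by
    have h1 : eLpNorm g p volume ≤ eLpNorm (∑ a, fun x => ‖g x a‖) p volume := by
      refine eLpNorm_mono_real fun x => ?_
      rw [Finset.sum_apply]
      have h2 : g x = ∑ a, EuclideanSpace.single a (g x a) := by
        ext i; simp [Pi.single_apply]
      conv_lhs => rw [h2]
      refine (norm_sum_le _ _).trans (le_of_eq ?_)
      simp
    refine h1.trans ((eLpNorm_sum_le (fun a _ => (hgac a).continuous.norm.aestronglyMeasurable)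
      hp1.le).trans (le_of_eq ?_))
    simp only [eLpNorm_norm]
  refine hsum.trans ((Finset.sum_le_sum fun a _ => hcomp a).trans (le_of_eq ?_))
  rw [← Finset.sum_mul, ENNReal.ofNNReal_finsetSum]

end Main

end ConstCoeff

theorem propositionA4 {n N M K : ℕ}
    (Dhat : Fin n → EuclideanSpace ℂ (Fin N) →L[ℂ] EuclideanSpace ℂ (Fin M))
    (A : EuclideanSpace ℂ (Fin M) →L[ℂ] EuclideanSpace ℂ (Fin K))
    (hDim : ∃ r : ℕ, ∀ ξ : EuclideanSpace ℝ (Fin n), ξ ≠ 0 →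
      Module.finrank ℂ (LinearMap.range (ConstCoeff.symbol Dhat ξ).toLinearMap) = r)
    (hA : ∃ c : ℝ, 0 < c ∧ ∀ (ξ : EuclideanSpace ℝ (Fin n)) (v : EuclideanSpace ℂ (Fin N)),
      c * ‖ConstCoeff.symbol Dhat ξ v‖ ≤ ‖A (ConstCoeff.symbol Dhat ξ v)‖)
    (p : ℝ≥0∞) (hp1 : 1 < p) (hp : p < ⊤) :
    ∃ C : ℝ, 0 < C ∧
      ∀ u : EuclideanSpace ℝ (Fin n) → EuclideanSpace ℂ (Fin N),
        ContDiff ℝ (∞ : ℕ∞ω) u → HasCompactSupport u →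
          ENNReal.ofReal C * eLpNorm (ConstCoeff.diffOp Dhat u) p volume ≤
            eLpNorm (fun x => A (ConstCoeff.diffOp Dhat u x)) p volume := by
  rcases Nat.eq_zero_or_pos n with rfl | hn
  -- In dimension zero the operator vanishes; the dyadic argument needs `0 < n`.
  · refine ⟨1, one_pos, fun u _ _ => ?_⟩
    have h0 : ConstCoeff.diffOp Dhat u = 0 := by
      ext1 x
      simp [ConstCoeff.diffOp]
    rw [h0]
    simp
  obtain ⟨r, hr⟩ := hDim
  obtain ⟨c, hc, hAc⟩ := hA
  obtain ⟨m, hsm, hhom, hbdd, hm⟩ := ConstCoeff.exists_multiplier (ConstCoeff.contDiff_symbol Dhat)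
    (ConstCoeff.symbol_smul Dhat) A (fun ξ v h => by
      have h1 := hAc ξ v
      rw [h, norm_zero] at h1
      exact norm_le_zero_iff.1 (nonpos_of_mul_nonpos_right h1 hc)) hr
  obtain ⟨C, hC⟩ := ConstCoeff.exists_eLpNorm_le_of_multiplier hn hsm hhom hbdd hp1 hp
  -- Adding one guards against `C = 0`.
  refine ⟨((C : ℝ) + 1)⁻¹, by positivity, fun u hu hus => ?_⟩
  have hg := ConstCoeff.contDiff_diffOp Dhat hu
  have hgs := ConstCoeff.hasCompactSupport_diffOp Dhat hus
  have hf : ContDiff ℝ ∞ fun x => A (ConstCoeff.diffOp Dhat u x) :=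
    (A.restrictScalars ℝ).contDiff.comp hg
  have hfs : HasCompactSupport fun x => A (ConstCoeff.diffOp Dhat u x) :=
    hgs.comp_left (map_zero A)
  -- The multiplier identity: `m ξ` undoes `A` on the transform of `Du`, which lies in the range of
  -- the symbol.
  have hkey := hC _ _ hf hfs hg hgs fun ξ => by
    rw [ConstCoeff.fourier_clm_comp A (hg.continuous.integrable_of_hasCompactSupport hgs)]
    have := ConstCoeff.fourier_diffOp Dhat (hus.toSchwartzMap hu) ξ
    rw [show (hus.toSchwartzMap hu : EuclideanSpace ℝ (Fin n) → _) = u from rfl] at this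
    rw [this, hm]
  have hC1 : ENNReal.ofReal ((C : ℝ) + 1)⁻¹ = ((C : ℝ≥0∞) + 1)⁻¹ := by
    rw [ENNReal.ofReal_inv_of_pos (by positivity), ENNReal.ofReal_add (by positivity) one_pos.le,
      ENNReal.ofReal_coe_nnreal, ENNReal.ofReal_one]
  rw [hC1]
  calc _ ≤ ((C : ℝ≥0∞) + 1)⁻¹ * (((C : ℝ≥0∞) + 1) * eLpNorm (fun x => A (ConstCoeff.diffOp Dhat u x)) p volume) := by
        gcongr
        refine hkey.trans ?_
        gcongr
        exact le_self_add
    _ = _ := by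
        rw [← mul_assoc, ENNReal.inv_mul_cancel (by simp) (by simp), one_mul]
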